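/- Let $D$ be the open unit disc. Let $H^2=H^2(\mathbb C,D)$ be the Hilbert space of analytic functions $f$ on $D$ with $$\|f\|^2=\sup_{0\le r<1}\frac1{2\pi}\int_0^{2\pi}|f(re^{i\theta})|^2\,d\theta<\infty ,$$ let $H^\infty(D)$ be the algebra of bounded analytic functions on $D$, and let $R$ be either $\mathbb C[z]$ or $H^\infty(D)$, acting on $H^2$ by pointwise multiplication. For $f$ in $R$ or $H^2$, let $\operatorname{ord}(f)\in\{0,1,2,\dots\}\cup\{\infty\}$ be the order of the zero of $f$ at $0$, and put $R_1=\{r\in R:\operatorname{ord}(r)\ge 1\}$. For a closed subspace $V\subseteq H^2$ and $k\ge 0$ let $$V_k=\{h\in V:\operatorname{ord}(h)\ge k\},\qquad W_k=V_k\ominus V_{k+1};$$ the $W_k$ are the components of the near homogeneous decomposition $V=W_0\oplus W_1\oplus W_2\oplus\cdots$. Let $P_m$ be the orthogonal projection of $H^2$ onto the $m$-th component of the near homogeneous decomposition of $H^2$ itself. The near homogeneous decomposition of $V$ is *near inner* if for all $k,m\ge 0$, $h\in W_k$, $g\in V$, $r\in R_1$ with $\operatorname{ord}(rh+g)>m$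 one has $rh+g\perp W_m$. It has the *full projection property* if for all $k,m\ge0$, $r\in R_1$, $h\in W_k$, $g\in V$ with $\operatorname{ord}(rh+g)\ge m$ one has $P_m(rh+g)\in P_m(W_m)$. An *inner function* is an $I\in H^\infty(D)$ whose radial boundary values $\lim_{r\to1^-}I(re^{i\theta})$ exist and have modulus $1$ for almost every $\theta$. **Theorem 8.1.** (i) Let $V\ne\{0\}$ be a closed subspace of $H^2$ whose near homogeneous decomposition is near inner and has the full projection property. Then $V$ is $R$-invariant, and there is an inner function $I$ such that $V=I\cdot H^2$. (ii) Conversely, if $I$ is an inner function, then $I\cdot H^2$ is a nonzero closed $R$-invariant subspace of $H^2$. (iii) Consequently (the classical Beurling theorem), a closed subspace $V\neq\{0\}$ of $H^2$ is $R$-invariant if and only if $V=I\cdot H^2$ for some inner function $I$. -/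

import Mathlib

open Filter Topology Complex
open scoped UnitDisc ComplexConjugate

noncomputable section

/-! ### Analytic functions on the unit disc -/

/-- Extension by zero of a function on the open unit disc `𝔻` to all of `ℂ`.
It only serves to apply notions stated for functions on `ℂ` at points of the disc. -/
def discExt (f : 𝔻 → ℂ) : ℂ → ℂ := fun z => if hz : ‖z‖ < 1 then f (UnitDisc.mk z hz) else 0

/-- `f` is analytic on the open unit disc. -/
def AnalyticOnDisc (f : 𝔻 → ℂ) : Prop := DifferentiableOn ℂ (discExt f) (Metric.ball 0 1)

/-- The order of the zero of `f` at the basepoint `0` (it is `⊤` iff `f` vanishes near `0`). -/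
def discOrd (f : 𝔻 → ℂ) : ℕ∞ := analyticOrderAt (discExt f) 0

/-- The `n`-th Taylor coefficient of `f` at `0`. -/
def taylorCoeff (f : 𝔻 → ℂ) (n : ℕ) : ℂ := (n.factorial : ℂ)⁻¹ * iteratedDeriv n (discExt f) 0

/-- The mean `(1 / 2π) ∫ |f(r e^{iθ})|² dθ` over the circle of radius `r`. -/
def circleMean (f : 𝔻 → ℂ) (r : ℝ) : ℝ := Real.circleAverage (fun z => ‖discExt f z‖ ^ 2) 0 r

theorem discExt_add (f g : 𝔻 → ℂ) : discExt (f + g) = discExt f + discExt g := by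
  ext z; by_cases h : ‖z‖ < 1 <;> simp [discExt, h]

theorem discExt_smul (c : ℂ) (f : 𝔻 → ℂ) : discExt (c • f) = c • discExt f := by
  ext z; by_cases h : ‖z‖ < 1 <;> simp [discExt, h]

theorem discExt_mul (f g : 𝔻 → ℂ) : discExt (f * g) = discExt f * discExt g := by
  ext z; by_cases h : ‖z‖ < 1 <;> simp [discExt, h]

theorem discExt_coe (f : 𝔻 → ℂ) (z : 𝔻) : discExt f z = f z := by
  simp [discExt, z.norm_lt_one]

theorem discExt_of (F : ℂ → ℂ) {z : ℂ} (hz : z ∈ Metric.ball (0 : ℂ) 1) :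
    discExt (fun w : 𝔻 => F w) z = F z := by
  rw [mem_ball_zero_iff] at hz
  simp [discExt, hz]

theorem AnalyticOnDisc.of {F : ℂ → ℂ} (hF : DifferentiableOn ℂ F (Metric.ball 0 1)) :
    AnalyticOnDisc (fun w : 𝔻 => F w) :=
  hF.congr fun _ hz => discExt_of F hz

theorem AnalyticOnDisc.add {f g : 𝔻 → ℂ} (hf : AnalyticOnDisc f) (hg : AnalyticOnDisc g) :
    AnalyticOnDisc (f + g) := by
  unfold AnalyticOnDisc; rw [discExt_add]; exact DifferentiableOn.add hf hg

theorem AnalyticOnDisc.smul {f : 𝔻 → ℂ} (c : ℂ) (hf : AnalyticOnDisc f) :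
    AnalyticOnDisc (c • f) := by
  unfold AnalyticOnDisc; rw [discExt_smul]; exact DifferentiableOn.const_smul hf c

theorem AnalyticOnDisc.mul {f g : 𝔻 → ℂ} (hf : AnalyticOnDisc f) (hg : AnalyticOnDisc g) :
    AnalyticOnDisc (f * g) := by
  unfold AnalyticOnDisc; rw [discExt_mul]; exact DifferentiableOn.mul hf hg

theorem AnalyticOnDisc.const (c : ℂ) : AnalyticOnDisc (fun _ => c) :=
  AnalyticOnDisc.of (F := fun _ => c) (differentiableOn_const c)

theorem AnalyticOnDisc.analyticAt {f : 𝔻 → ℂ} (hf : AnalyticOnDisc f) :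
    AnalyticAt ℂ (discExt f) 0 :=
  DifferentiableOn.analyticAt hf (Metric.ball_mem_nhds 0 one_pos)

theorem AnalyticOnDisc.hasSum {f : 𝔻 → ℂ} (hf : AnalyticOnDisc f) {z : ℂ}
    (hz : z ∈ Metric.ball (0 : ℂ) 1) :
    HasSum (fun n => taylorCoeff f n * z ^ n) (discExt f z) := by
  convert! Complex.hasSum_taylorSeries_on_ball hf hz using 2 with n
  simp [taylorCoeff]; ring

theorem AnalyticOnDisc.taylorCoeff_add {f g : 𝔻 → ℂ} (hf : AnalyticOnDisc f)
    (hg : AnalyticOnDisc g) (n : ℕ) :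
    taylorCoeff (f + g) n = taylorCoeff f n + taylorCoeff g n := by
  simp only [taylorCoeff, discExt_add]
  rw [iteratedDeriv_add hf.analyticAt.contDiffAt hg.analyticAt.contDiffAt, mul_add]

theorem taylorCoeff_smul (c : ℂ) (f : 𝔻 → ℂ) (n : ℕ) :
    taylorCoeff (c • f) n = c * taylorCoeff f n := by
  simp only [taylorCoeff, discExt_smul]
  rw [iteratedDeriv_const_smul_field]
  simp; ring

theorem AnalyticOnDisc.le_discOrd_iff {f : 𝔻 → ℂ} (hf : AnalyticOnDisc f) (n : ℕ) :
    (n : ℕ∞) ≤ discOrd f ↔ ∀ i < n, taylorCoeff f i = 0 := by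
  rw [discOrd, natCast_le_analyticOrderAt_iff_iteratedDeriv_eq_zero hf.analyticAt]
  simp [taylorCoeff, Nat.factorial_ne_zero]

theorem circle_mem_ball {r : ℝ} (h0 : 0 ≤ r) (h1 : r < 1) {z : ℂ}
    (hz : z ∈ Metric.sphere (0 : ℂ) |r|) : z ∈ Metric.ball (0 : ℂ) 1 := by
  rw [mem_sphere_zero_iff_norm, abs_of_nonneg h0] at hz
  rw [mem_ball_zero_iff, hz]; exact h1

/-- Parseval's identity on the circle of radius `r < 1`. -/
theorem AnalyticOnDisc.hasSum_circleMean {f : 𝔻 → ℂ} (hf : AnalyticOnDisc f) {r : ℝ}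
    (h0 : 0 ≤ r) (h1 : r < 1) :
    HasSum (fun n => ‖taylorCoeff f n‖ ^ 2 * r ^ (2 * n)) (circleMean f r) := by
  have hsum : Summable fun n => ‖taylorCoeff f n‖ * r ^ n := by
    have hr : (r : ℂ) ∈ Metric.ball (0 : ℂ) 1 := by
      simpa [abs_of_nonneg h0] using h1
    simpa [abs_of_nonneg h0] using (hf.hasSum hr).summable.norm
  rw [hasSum_iff_tendsto_nat_of_nonneg
    (fun n => mul_nonneg (by positivity) (pow_nonneg h0 _))]
  let p : ℕ → Polynomial ℂ := fun N =>
    ∑ n ∈ Finset.range N, Polynomial.monomial n (taylorCoeff f n * (r : ℂ) ^ n)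
  have hcoeff : ∀ N i, (p N).coeff i = if i < N then taylorCoeff f i * (r : ℂ) ^ i else 0 := by
    intro N i
    simp [p, Polynomial.coeff_monomial]
  have hP : ∀ N, ∑ i ∈ Finset.range N, ‖taylorCoeff f i‖ ^ 2 * r ^ (2 * i) =
      Real.circleAverage (fun z => ‖(p N).eval z‖ ^ 2) 0 1 := by
    intro N
    rw [← Polynomial.sum_sq_norm_coeff_eq_circleAverage]
    have hsub : (p N).support ⊆ Finset.range N := by
      intro i hi
      by_contra h
      rw [Polynomial.mem_support_iff, hcoeff] at hi
      simp only [Finset.mem_range] at h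
      simp [h] at hi
    rw [Finset.sum_subset hsub]
    · refine Finset.sum_congr rfl fun i hi => ?_
      rw [hcoeff, if_pos (Finset.mem_range.1 hi), norm_mul, norm_pow, Complex.norm_real,
        Real.norm_eq_abs, abs_of_nonneg h0]
      ring
    · intro i _ hi
      simp [Polynomial.notMem_support_iff.1 hi]
  have heval : ∀ N z, (p N).eval z = ∑ n ∈ Finset.range N, taylorCoeff f n * (r * z) ^ n := by
    intro N z
    simp only [p, Polynomial.eval_finsetSum, Polynomial.eval_monomial]
    exact Finset.sum_congr rfl fun n _ => by ring
  simp_rw [hP]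
  rw [circleMean, Real.circleAverage_eq_circleAverage_zero_one]
  simp only [Real.circleAverage_def, add_zero]
  refine Tendsto.const_smul ?_ _
  refine intervalIntegral.tendsto_integral_filter_of_dominated_convergence
    (fun _ => (∑' n, ‖taylorCoeff f n‖ * r ^ n) ^ 2) ?_ ?_ intervalIntegrable_const ?_
  · refine Eventually.of_forall fun N => Continuous.aestronglyMeasurable ?_
    have : Continuous fun z : ℂ => (p N).eval z := (p N).continuous
    fun_prop
  · refine Eventually.of_forall fun N => Eventually.of_forall fun θ _ => ?_
    rw [Real.norm_eq_abs, abs_of_nonneg (by positivity), heval]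
    gcongr
    refine (norm_sum_le _ _).trans ?_
    refine le_trans (le_of_eq ?_) (hsum.sum_le_tsum (Finset.range N)
      (fun n _ => mul_nonneg (norm_nonneg _) (pow_nonneg h0 n)))
    refine Finset.sum_congr rfl fun n _ => ?_
    simp [abs_of_nonneg h0]
  · refine Eventually.of_forall fun θ _ => ?_
    have hz : (r : ℂ) * circleMap 0 1 θ ∈ Metric.ball (0 : ℂ) 1 := by
      simpa [abs_of_nonneg h0] using h1
    have := (hf.hasSum hz).tendsto_sum_nat
    simp only [heval]
    exact (this.norm).pow 2

theorem AnalyticOnDisc.circleMean_le {f : 𝔻 → ℂ} (hf : AnalyticOnDisc f)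
    (hs : Summable fun n => ‖taylorCoeff f n‖ ^ 2) {r : ℝ} (h0 : 0 ≤ r) (h1 : r < 1) :
    circleMean f r ≤ ∑' n, ‖taylorCoeff f n‖ ^ 2 := by
  refine hasSum_le (fun n => ?_) (hf.hasSum_circleMean h0 h1) hs.hasSum
  exact mul_le_of_le_one_right (by positivity) (pow_le_one₀ h0 h1.le)

theorem AnalyticOnDisc.sum_le {f : 𝔻 → ℂ} (hf : AnalyticOnDisc f) {C : ℝ}
    (hC : ∀ r : ℝ, 0 ≤ r → r < 1 → circleMean f r ≤ C) (s : Finset ℕ) :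
    ∑ n ∈ s, ‖taylorCoeff f n‖ ^ 2 ≤ C := by
  have hlim : Tendsto (fun r : ℝ => ∑ n ∈ s, ‖taylorCoeff f n‖ ^ 2 * r ^ (2 * n)) (𝓝[<] 1)
      (𝓝 (∑ n ∈ s, ‖taylorCoeff f n‖ ^ 2)) := by
    have : Continuous (fun r : ℝ => ∑ n ∈ s, ‖taylorCoeff f n‖ ^ 2 * r ^ (2 * n)) := by fun_prop
    have h := this.tendsto 1
    simp only [one_pow, mul_one] at h
    exact h.mono_left nhdsWithin_le_nhds
  refine le_of_tendsto hlim ?_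
  filter_upwards [Ioo_mem_nhdsLT (zero_lt_one : (0 : ℝ) < 1)] with r hr
  refine le_trans ?_ (hC r hr.1.le hr.2)
  exact sum_le_hasSum s (fun n _ => mul_nonneg (by positivity) (pow_nonneg hr.1.le _))
    (hf.hasSum_circleMean hr.1.le hr.2)

theorem AnalyticOnDisc.summable_iff {f : 𝔻 → ℂ} (hf : AnalyticOnDisc f) :
    (Summable fun n => ‖taylorCoeff f n‖ ^ 2) ↔
      ∃ C : ℝ, ∀ r : ℝ, 0 ≤ r → r < 1 → circleMean f r ≤ C := by
  refine ⟨fun hs => ⟨_, fun r h0 h1 => hf.circleMean_le hs h0 h1⟩, fun ⟨C, hC⟩ => ?_⟩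
  exact summable_of_sum_le (fun n => by positivity) (hf.sum_le hC)

/-! ### The Hardy space `H²(ℂ, D)` and the algebra `H^∞(D)` -/

theorem summable_sq_add {a b : ℕ → ℂ} (ha : Summable fun n => ‖a n‖ ^ 2)
    (hb : Summable fun n => ‖b n‖ ^ 2) : Summable fun n => ‖a n + b n‖ ^ 2 := by
  refine Summable.of_nonneg_of_le (fun n => by positivity) (fun n => ?_)
    ((ha.add hb).mul_left 2)
  have := norm_add_le (a n) (b n)
  nlinarith [sq_nonneg (‖a n‖ - ‖b n‖), norm_nonneg (a n + b n), norm_nonneg (a n),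
    norm_nonneg (b n)]

/-- The linear space of analytic functions on the disc whose square means over the circles
of radius `r < 1` are bounded. -/
def hardySubmodule : Submodule ℂ (𝔻 → ℂ) where
  carrier := {f | AnalyticOnDisc f ∧ ∃ C : ℝ, ∀ r : ℝ, 0 ≤ r → r < 1 → circleMean f r ≤ C}
  zero_mem' := ⟨AnalyticOnDisc.const 0, 0, fun r _ _ => by
    have : discExt 0 = 0 := by ext z; simp [discExt]
    simp [circleMean, this, Real.circleAverage_const]⟩
  add_mem' := by
    rintro f g ⟨hf, hf'⟩ ⟨hg, hg'⟩
    refine ⟨hf.add hg, ?_⟩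
    rw [← hf.summable_iff] at hf'
    rw [← hg.summable_iff] at hg'
    rw [← (hf.add hg).summable_iff]
    simp only [hf.taylorCoeff_add hg]
    exact summable_sq_add hf' hg'
  smul_mem' := by
    rintro c f ⟨hf, hf'⟩
    refine ⟨hf.smul c, ?_⟩
    rw [← hf.summable_iff] at hf'
    rw [← (hf.smul c).summable_iff]
    simp only [taylorCoeff_smul, norm_mul, mul_pow]
    exact hf'.mul_left _

/-- The Hardy space `H²(ℂ, D)`; its elements are functions on the disc. -/
def HardyTwo : Type := hardySubmodule

namespace HardyTwo

instance : AddCommGroup HardyTwo := inferInstanceAs (AddCommGroup hardySubmodule)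
instance : Module ℂ HardyTwo := inferInstanceAs (Module ℂ hardySubmodule)

/-- The underlying function on the disc. -/
def toFun (f : HardyTwo) : 𝔻 → ℂ := Subtype.val f

theorem analytic (f : HardyTwo) : AnalyticOnDisc f.toFun := (Subtype.prop f).1

theorem bounded (f : HardyTwo) :
    ∃ C : ℝ, ∀ r : ℝ, 0 ≤ r → r < 1 → circleMean f.toFun r ≤ C := (Subtype.prop f).2

theorem toFun_add (f g : HardyTwo) : (f + g).toFun = f.toFun + g.toFun := rfl
theorem toFun_smul (c : ℂ) (f : HardyTwo) : (c • f).toFun = c • f.toFun := rfl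
theorem toFun_injective : Function.Injective toFun := Subtype.val_injective

theorem summable (f : HardyTwo) : Summable fun n => ‖taylorCoeff f.toFun n‖ ^ 2 :=
  f.analytic.summable_iff.2 f.bounded

/-- The sequence of Taylor coefficients, as an element of `ℓ²`. -/
def toSeq : HardyTwo →ₗ[ℂ] lp (fun _ : ℕ => ℂ) 2 where
  toFun f := ⟨taylorCoeff f.toFun, memℓp_gen (by simpa using f.summable)⟩
  map_add' f g := by
    ext n; exact f.analytic.taylorCoeff_add g.analytic n
  map_smul' c f := by
    ext n; exact taylorCoeff_smul c f.toFun n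

theorem toSeq_apply (f : HardyTwo) (n : ℕ) : toSeq f n = taylorCoeff f.toFun n := rfl

theorem toSeq_injective : Function.Injective toSeq := by
  intro f g h
  apply toFun_injective
  ext z
  rw [← discExt_coe f.toFun, ← discExt_coe g.toFun]
  have hz : (z : ℂ) ∈ Metric.ball (0 : ℂ) 1 := mem_ball_zero_iff.2 z.norm_lt_one
  refine (f.analytic.hasSum hz).unique ?_
  have := g.analytic.hasSum hz
  simpa only [← toSeq_apply, h] using this

/-- The Hardy space norm and inner product, `⟪f, g⟫ = ∑ conj (aₙ) bₙ` in terms of Taylor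
coefficients. By `HardyTwo.norm_sq_eq` below this is the norm given by
`‖f‖² = sup_{0 ≤ r < 1} (1 / 2π) ∫ |f(r e^{iθ})|² dθ`. -/
instance : NormedAddCommGroup HardyTwo :=
  NormedAddCommGroup.induced HardyTwo (lp (fun _ : ℕ => ℂ) 2) toSeq toSeq_injective

instance : InnerProductSpace ℂ HardyTwo := InnerProductSpace.induced toSeq

theorem norm_eq (f : HardyTwo) : ‖f‖ = ‖toSeq f‖ := rfl

theorem norm_sq_eq_tsum (f : HardyTwo) : ‖f‖ ^ 2 = ∑' n, ‖taylorCoeff f.toFun n‖ ^ 2 := by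
  have := lp.norm_rpow_eq_tsum (p := 2) (by simp) (toSeq f)
  simpa [norm_eq, toSeq_apply] using this

/-- The norm is the classical Hardy space norm. -/
theorem norm_sq_eq (f : HardyTwo) :
    IsLUB ((circleMean f.toFun) '' Set.Ico 0 1) (‖f‖ ^ 2) := by
  rw [norm_sq_eq_tsum]
  refine ⟨?_, fun C hC => ?_⟩
  · rintro _ ⟨r, hr, rfl⟩
    exact f.analytic.circleMean_le f.summable hr.1 hr.2
  · exact f.summable.tsum_le_of_sum_le
      (f.analytic.sum_le fun r h0 h1 => hC ⟨r, ⟨h0, h1⟩, rfl⟩)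

theorem toSeq_surjective : Function.Surjective toSeq := by
  intro a
  let P := FormalMultilinearSeries.ofScalars ℂ (fun n => a n)
  have hrad : (1 : ENNReal) ≤ P.radius := by
    refine P.le_radius_of_bound (r := 1) ‖a‖ fun n => ?_
    simpa [P] using lp.norm_apply_le_norm two_ne_zero a n
  have hB : HasFPowerSeriesOnBall P.sum P 0 1 :=
    (P.hasFPowerSeriesOnBall (one_pos.trans_le hrad)).mono one_pos hrad
  have hd : DifferentiableOn ℂ P.sum (Metric.ball 0 1) := by
    have := hB.differentiableOn
    rwa [← ENNReal.coe_one, Metric.eball_coe] at this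
  let f : 𝔻 → ℂ := fun w => P.sum w
  have hf : AnalyticOnDisc f := AnalyticOnDisc.of hd
  have hc : ∀ n, taylorCoeff f n = a n := by
    intro n
    have he : discExt f =ᶠ[𝓝 0] P.sum := by
      filter_upwards [Metric.ball_mem_nhds (0 : ℂ) one_pos] with z hz
      exact discExt_of _ hz
    have h1 := hB.hasFPowerSeriesAt.eq_formalMultilinearSeries hB.analyticAt.hasFPowerSeriesAt
    have h2 := congrFun (FormalMultilinearSeries.ofScalars_series_injective ℂ ℂ h1) n
    rw [taylorCoeff, he.iteratedDeriv_eq, h2, div_eq_inv_mul]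
  have hs : Summable fun n => ‖taylorCoeff f n‖ ^ 2 := by
    simp only [hc]
    simpa using (lp.memℓp a).summable (by simp)
  refine ⟨⟨f, hf, hf.summable_iff.1 hs⟩, ?_⟩
  ext n
  exact hc n

/-- `H²` is complete, that is, a Hilbert space. -/
instance : CompleteSpace HardyTwo := by
  have e : HardyTwo ≃ᵢ lp (fun _ : ℕ => ℂ) 2 :=
    ⟨Equiv.ofBijective toSeq ⟨toSeq_injective, toSeq_surjective⟩,
      AddMonoidHomClass.isometry_of_norm toSeq fun f => rfl⟩
  exact e.completeSpace

/-- The order of the zero at `0`. -/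
def ord (f : HardyTwo) : ℕ∞ := discOrd f.toFun

end HardyTwo

/-- The algebra `H^∞(D)` of bounded analytic functions on the disc. -/
def HInfty : Subalgebra ℂ (𝔻 → ℂ) where
  carrier := {r | AnalyticOnDisc r ∧ ∃ C : ℝ, ∀ z, ‖r z‖ ≤ C}
  mul_mem' := by
    rintro f g ⟨hf, C, hC⟩ ⟨hg, C', hC'⟩
    refine ⟨hf.mul hg, C * C', fun z => ?_⟩
    rw [Pi.mul_apply, norm_mul]
    exact mul_le_mul (hC z) (hC' z) (norm_nonneg _) ((norm_nonneg _).trans (hC z))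
  add_mem' := by
    rintro f g ⟨hf, C, hC⟩ ⟨hg, C', hC'⟩
    exact ⟨hf.add hg, C + C', fun z => (norm_add_le _ _).trans (add_le_add (hC z) (hC' z))⟩
  algebraMap_mem' c := ⟨AnalyticOnDisc.const c, ‖c‖, fun _ => le_rfl⟩

/-- The coordinate function `z`, as an element of `H^∞(D)`. -/
def coordZ : HInfty :=
  ⟨fun w => (w : ℂ), AnalyticOnDisc.of (F := id) differentiableOn_id, 1, fun z => z.norm_lt_one.le⟩

/-- The algebra `ℂ[z]` of polynomial functions on the disc. -/
def polyAlgebra : Subalgebra ℂ HInfty := Algebra.adjoin ℂ {coordZ}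

/-- The order of the zero at `0` of an element of `H^∞(D)`. -/
def hInftyOrd (r : HInfty) : ℕ∞ := discOrd r.1

theorem hInfty_mul_mem (r : HInfty) (f : HardyTwo) : r.1 * f.toFun ∈ hardySubmodule := by
  obtain ⟨hr, C, hC⟩ := r.2
  obtain ⟨M, hM⟩ := f.bounded
  refine ⟨hr.mul f.analytic, C ^ 2 * M, fun s h0 h1 => ?_⟩
  refine le_trans ?_ (mul_le_mul_of_nonneg_left (hM s h0 h1) (sq_nonneg C))
  have hc : ∀ {g : 𝔻 → ℂ}, AnalyticOnDisc g →
      CircleIntegrable (fun z => ‖discExt g z‖ ^ 2) 0 s := fun {g} hg =>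
    ContinuousOn.circleIntegrable' <|
      ((DifferentiableOn.continuousOn hg).mono fun _ hz => circle_mem_ball h0 h1 hz).norm.pow 2
  change Real.circleAverage (fun z => ‖discExt (r.1 * f.toFun) z‖ ^ 2) 0 s ≤
    C ^ 2 • Real.circleAverage (fun z => ‖discExt f.toFun z‖ ^ 2) 0 s
  rw [← Real.circleAverage_fun_smul]
  refine Real.circleAverage_mono (hc (hr.mul f.analytic)) ((hc f.analytic).const_mul _) ?_
  intro z hz
  have hz' := mem_ball_zero_iff.1 (circle_mem_ball h0 h1 hz)
  rw [discExt_mul, Pi.mul_apply, norm_mul, mul_pow, smul_eq_mul]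
  have : ‖discExt r.1 z‖ ≤ C := by
    simpa [discExt, hz'] using hC (UnitDisc.mk z hz')
  gcongr

/-- `H²(ℂ, D)` is a module over `H^∞(D)` (hence over each of its subalgebras) by pointwise
multiplication. -/
instance : Module HInfty HardyTwo where
  smul r f := ⟨r.1 * f.toFun, hInfty_mul_mem r f⟩
  one_smul f := Subtype.ext (one_mul f.toFun)
  mul_smul r s f := Subtype.ext (mul_assoc r.1 s.1 f.toFun)
  smul_zero r := Subtype.ext (mul_zero r.1)
  smul_add r f g := Subtype.ext (mul_add r.1 f.toFun g.toFun)
  add_smul r s f := Subtype.ext (add_mul r.1 s.1 f.toFun)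
  zero_smul f := Subtype.ext (zero_mul f.toFun)

theorem HardyTwo.toFun_hsmul (r : HInfty) (f : HardyTwo) : (r • f).toFun = r.1 * f.toFun := rfl

/-! ### The near homogeneous decomposition -/

/-- The terms `V_k = {h ∈ V : ord h ≥ k}` of the valuation subspace series of `V`. -/
def valSub (V : Submodule ℂ HardyTwo) (k : ℕ) : Submodule ℂ HardyTwo where
  carrier := {h | h ∈ V ∧ (k : ℕ∞) ≤ h.ord}
  zero_mem' := ⟨V.zero_mem, by
    rw [HardyTwo.ord, (0 : HardyTwo).analytic.le_discOrd_iff]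
    intro i _
    rw [← HardyTwo.toSeq_apply, map_zero]; rfl⟩
  add_mem' := by
    rintro f g ⟨hf, hf'⟩ ⟨hg, hg'⟩
    refine ⟨V.add_mem hf hg, ?_⟩
    rw [HardyTwo.ord, (HardyTwo.analytic _).le_discOrd_iff] at *
    intro i hi
    rw [HardyTwo.toFun_add, f.analytic.taylorCoeff_add g.analytic, hf' i hi, hg' i hi, add_zero]
  smul_mem' := by
    rintro c f ⟨hf, hf'⟩
    refine ⟨V.smul_mem c hf, ?_⟩
    rw [HardyTwo.ord, (HardyTwo.analytic _).le_discOrd_iff] at *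
    intro i hi
    rw [HardyTwo.toFun_smul, taylorCoeff_smul, hf' i hi, mul_zero]

/-- The near homogeneous component `W_k = V_k ⊖ V_{k+1}` of `V`. -/
def nearHomComp (V : Submodule ℂ HardyTwo) (k : ℕ) : Submodule ℂ HardyTwo :=
  valSub V k ⊓ (valSub V (k + 1))ᗮ

theorem isClosed_valSub_top (k : ℕ) : IsClosed (valSub ⊤ k : Set HardyTwo) := by
  have hcont : ∀ i : ℕ, Continuous fun h : HardyTwo => HardyTwo.toSeq h i := by
    intro i
    have h1 : Isometry HardyTwo.toSeq :=
      AddMonoidHomClass.isometry_of_norm HardyTwo.toSeq fun f => rfl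
    exact (lp.evalCLM ℂ (fun _ : ℕ => ℂ) 2 i).continuous.comp h1.continuous
  have : (valSub ⊤ k : Set HardyTwo) = ⋂ i, ⋂ _ : i < k, {h | HardyTwo.toSeq h i = 0} := by
    ext h
    simp only [Set.mem_iInter, Set.mem_ofPred_eq]
    change (h ∈ (⊤ : Submodule ℂ HardyTwo) ∧ (k : ℕ∞) ≤ h.ord) ↔ _
    rw [HardyTwo.ord, h.analytic.le_discOrd_iff]
    simp [HardyTwo.toSeq_apply]
  rw [this]
  exact isClosed_iInter fun i => isClosed_iInter fun _ => isClosed_eq (hcont i) continuous_const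

instance (m : ℕ) : CompleteSpace (nearHomComp ⊤ m) :=
  ((isClosed_valSub_top m).inter (Submodule.isClosed_orthogonal _)).completeSpace_coe

/-- The orthogonal projection `P_m` of `H²` onto its own near homogeneous component `H_m`. -/
def homProj (m : ℕ) : HardyTwo →L[ℂ] HardyTwo := (nearHomComp ⊤ m).starProjection

/-- The near homogeneous decomposition of `V` is near inner, with respect to the algebra `R`;
`R_1` consists of the `r ∈ R` with `ord r ≥ 1`. -/
def IsNearInner (R : Subalgebra ℂ HInfty) (V : Submodule ℂ HardyTwo) : Prop :=
  ∀ k m : ℕ, ∀ h ∈ nearHomComp V k, ∀ g ∈ V, ∀ r ∈ R, 1 ≤ hInftyOrd r →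
    (m : ℕ∞) < (r • h + g).ord → r • h + g ∈ (nearHomComp V m)ᗮ

/-- The near homogeneous decomposition of `V` has the full projection property, with respect to
the algebra `R`. -/
def HasFullProjection (R : Subalgebra ℂ HInfty) (V : Submodule ℂ HardyTwo) : Prop :=
  ∀ k m : ℕ, ∀ r ∈ R, 1 ≤ hInftyOrd r → ∀ h ∈ nearHomComp V k, ∀ g ∈ V,
    (m : ℕ∞) ≤ (r • h + g).ord → homProj m (r • h + g) ∈ homProj m '' (nearHomComp V m)

/-- `V` is `R` invariant. -/
def IsInvariantUnder (R : Subalgebra ℂ HInfty) (V : Submodule ℂ HardyTwo) : Prop :=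
  ∀ r ∈ R, ∀ h ∈ V, r • h ∈ V

/-! ### Inner functions -/

/-- `I ∈ H^∞(D)` is an inner function: for almost every `θ` the radial boundary value
`lim_{r → 1⁻} I(r e^{iθ})` exists and has modulus `1`. -/
def IsInnerFunction (I : HInfty) : Prop :=
  ∀ᵐ θ : ℝ, ∃ c : ℂ, ‖c‖ = 1 ∧
    Tendsto (fun r : ℝ => discExt I.1 (r * Complex.exp (θ * Complex.I))) (𝓝[<] 1) (𝓝 c)

/-- The subspace `I · H²` of `H²`. -/
def mulHardy (I : HInfty) : Submodule ℂ HardyTwo where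
  carrier := {h | ∃ f : HardyTwo, h = I • f}
  zero_mem' := ⟨0, (smul_zero I).symm⟩
  add_mem' := by
    rintro _ _ ⟨f, rfl⟩ ⟨g, rfl⟩
    exact ⟨f + g, (smul_add I f g).symm⟩
  smul_mem' := by
    rintro c _ ⟨f, rfl⟩
    exact ⟨c • f, Subtype.ext (mul_smul_comm c I.1 f.toFun).symm⟩

end

/-!
For `r ∈ R` vanishing at `0` and `h` in some `W_k`, the full projection property approximates `rh`
by elements of `V` to every order at `0`; near innerness makes these differences orthogonal to the
components `W_i` of lower index, so that `rh` and its projection to `V` agree to every order at `0`.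
Since the `W_k` span a dense subspace of the closed space `V`, this gives invariance.

For a closed `V ≠ 0` with `zV ⊆ V`, choose a unit vector `φ ∈ V ⊖ zV`. Its orbit `zⁿφ` is
orthonormal, hence multiplication by `φ` is isometric on `H²`, which forces `φ` to be bounded. The
orbit of `φ` spans a dense subspace of `V`: otherwise the same construction in its orthogonal
complement in `V` gives a second function `ψ` whose orbit is orthogonal to that of `φ`, although
both closed spans contain `φψ`.

Multiplication by a bounded `J` is isometric exactly when `J` is inner, because `‖f‖²` is the mean
square of the radial limits of a bounded `f`. The radial limits exist by Fatou's theorem: `J` is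
the derivative of a function that is Lipschitz on the closed disc, hence differentiable almost
everywhere along the circle, and there the Poisson kernel transfers the derivative to the radius.
-/

noncomputable section

/-! ### Isometries of Hilbert spaces -/

section Isometry

variable {𝕜 E : Type*} [RCLike 𝕜] [NormedAddCommGroup E] [InnerProductSpace 𝕜 E]

theorem mem_of_mem_orthogonal_inf_orthogonal {K L : Submodule 𝕜 E} [K.HasOrthogonalProjection]
    (hKL : K ≤ L) {x : E} (hx : x ∈ L) (hxo : x ∈ (L ⊓ Kᗮ)ᗮ) : x ∈ K := by
  rw [← Submodule.sup_orthogonal_inf_of_hasOrthogonalProjection hKL] at hx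
  obtain ⟨y, hy, w, hw, rfl⟩ := Submodule.mem_sup.1 hx
  have hw' : w ∈ L ⊓ Kᗮ := ⟨hw.2, hw.1⟩
  have hwo : w ∈ (L ⊓ Kᗮ)ᗮ :=
    (add_mem_cancel_left (Submodule.orthogonal_le inf_le_right (K.le_orthogonal_orthogonal hy))).1
      hxo
  rwa [Submodule.disjoint_def.1 (L ⊓ Kᗮ).orthogonal_disjoint w hw' hwo, add_zero]

theorem mem_orthogonal_span_range_iff {ι : Type*} {v : ι → E} {x : E} :
    x ∈ (Submodule.span 𝕜 (Set.range v))ᗮ ↔ ∀ i, inner 𝕜 (v i) x = 0 := by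
  simp only [Submodule.span_range_eq_iSup, ← Submodule.iInf_orthogonal, Submodule.mem_iInf,
    Submodule.mem_orthogonal_singleton_iff_inner_right]

variable (S : E →ₗᵢ[𝕜] E)

theorem inner_iterate_iterate_add (f g : E) (n m : ℕ) :
    inner 𝕜 (S^[n] f) (S^[n + m] g) = inner 𝕜 f (S^[m] g) := by
  induction n with
  | zero => simp
  | succ n ih => rw [Nat.succ_add, Function.iterate_succ_apply', Function.iterate_succ_apply',
      S.inner_map_map, ih]

theorem orthonormal_iterate {f : E} (hf : ‖f‖ = 1) (h : ∀ n, inner 𝕜 f (S^[n + 1] f) = 0) :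
    Orthonormal 𝕜 fun n => S^[n] f := by
  have horth {n m : ℕ} (hnm : n < m) : inner 𝕜 (S^[n] f) (S^[m] f) = 0 := by
    obtain ⟨k, rfl⟩ := Nat.exists_eq_add_of_lt hnm
    rw [add_assoc, inner_iterate_iterate_add, h]
  refine ⟨fun n => ?_, fun n m hnm => ?_⟩
  · induction n with
    | zero => exact hf
    | succ n ih => simpa only [Function.iterate_succ_apply', S.norm_map] using ih
  · exact hnm.lt_or_gt.elim horth fun hmn => inner_eq_zero_symm.1 (horth hmn)

theorem inner_iterate_iterate_eq_zero {f g : E} (hfg : ∀ n, inner 𝕜 (S^[n] f) g = 0)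
    (hgf : ∀ n, inner 𝕜 (S^[n] g) f = 0) (n m : ℕ) : inner 𝕜 (S^[n] f) (S^[m] g) = 0 := by
  obtain ⟨k, rfl⟩ | ⟨k, rfl⟩ := (le_total n m).imp Nat.exists_eq_add_of_le Nat.exists_eq_add_of_le
  · rw [inner_iterate_iterate_add, inner_eq_zero_symm, hgf]
  · rw [inner_eq_zero_symm, inner_iterate_iterate_add, inner_eq_zero_symm, hfg]

end Isometry

/-! ### Monomials, point evaluations and multiplication operators -/

theorem coe_unitDisc_mem_ball (z : 𝔻) : (z : ℂ) ∈ Metric.ball (0 : ℂ) 1 :=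
  mem_ball_zero_iff.2 z.norm_lt_one

namespace HardyTwo

theorem hasSum_toFun (f : HardyTwo) (z : 𝔻) :
    HasSum (fun n => taylorCoeff f.toFun n * (z : ℂ) ^ n) (f.toFun z) := by
  rw [← discExt_coe f.toFun]
  exact f.analytic.hasSum (coe_unitDisc_mem_ball z)

theorem norm_taylorCoeff_le (f : HardyTwo) (n : ℕ) : ‖taylorCoeff f.toFun n‖ ≤ ‖f‖ :=
  lp.norm_apply_le_norm two_ne_zero (toSeq f) n

/-- Evaluation at a point of the disc. -/
def evalCLM (z : 𝔻) : HardyTwo →L[ℂ] ℂ :=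
  LinearMap.mkContinuous
    { toFun := fun f => f.toFun z
      map_add' := fun _ _ => rfl
      map_smul' := fun _ _ => rfl } (1 - ‖(z : ℂ)‖)⁻¹ fun f => by
    have hgeom := (hasSum_geometric_of_lt_one (norm_nonneg (z : ℂ)) z.norm_lt_one).mul_right ‖f‖
    change ‖f.toFun z‖ ≤ _
    rw [← (f.hasSum_toFun z).tsum_eq]
    refine tsum_of_norm_bounded hgeom fun n => ?_
    rw [norm_mul, norm_pow, mul_comm]
    exact mul_le_mul_of_nonneg_left (f.norm_taylorCoeff_le n) (by positivity)

theorem evalCLM_apply (z : 𝔻) (f : HardyTwo) : evalCLM z f = f.toFun z := rfl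

/-- The orthonormal basis `1, z, z², …` of `H²`. -/
def monomialBasis : HilbertBasis ℕ ℂ HardyTwo :=
  .ofRepr (LinearIsometryEquiv.ofSurjective ⟨toSeq, fun _ => rfl⟩ toSeq_surjective)

theorem monomialBasis_repr_apply (f : HardyTwo) (n : ℕ) :
    monomialBasis.repr f n = taylorCoeff f.toFun n := rfl

theorem monomialBasis_toFun (n : ℕ) (z : 𝔻) : (monomialBasis n).toFun z = (z : ℂ) ^ n := by
  refine ((monomialBasis n).hasSum_toFun z).unique ?_
  convert hasSum_single n fun m hm => ?_ using 1
  · rw [← monomialBasis_repr_apply, monomialBasis.repr_self, lp.single_apply_self, one_mul]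
  · rw [← monomialBasis_repr_apply, monomialBasis.repr_self, lp.single_apply_ne _ _ _ hm, zero_mul]

/-- Multiplication by a bounded analytic function, as a continuous linear map. -/
def mulCLM (r : HInfty) : HardyTwo →L[ℂ] HardyTwo :=
  ContinuousLinearMap.ofSeqClosedGraph
    (g :=
      { toFun := fun f => r • f
        map_add' := smul_add r
        map_smul' := fun c f => Subtype.ext (mul_smul_comm c r.1 f.toFun) })
    fun _ f g hu hru => toFun_injective <| funext fun z =>
      tendsto_nhds_unique (((evalCLM z).continuous.tendsto g).comp hru)
        ((((evalCLM z).continuous.tendsto f).comp hu).const_mul (r.1 z))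

theorem norm_le_of_toFun_eq_mul {φ : 𝔻 → ℂ} (T : HardyTwo →L[ℂ] HardyTwo)
    (hT : ∀ f, (T f).toFun = φ * f.toFun) (z : 𝔻) : ‖φ z‖ ≤ ‖T‖ := by
  obtain hφ | hφ := (norm_nonneg (φ z)).eq_or_lt
  · exact hφ ▸ T.opNorm_nonneg
  have hpos : 0 < ‖evalCLM z‖ := by
    refine (evalCLM z).opNorm_nonneg.lt_of_ne' (mt (evalCLM z).opNorm_zero_iff.1 fun h => ?_)
    simpa [evalCLM_apply, monomialBasis_toFun] using DFunLike.congr_fun h (monomialBasis 0)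
  have hle : ‖evalCLM z‖ ≤ ‖evalCLM z‖ * ‖T‖ / ‖φ z‖ := by
    refine (evalCLM z).opNorm_le_bound (by positivity) fun f => ?_
    calc ‖f.toFun z‖ = ‖evalCLM z (T f)‖ / ‖φ z‖ := by
          rw [evalCLM_apply, hT, Pi.mul_apply, norm_mul, mul_div_cancel_left₀ _ hφ.ne']
      _ ≤ ‖evalCLM z‖ * (‖T‖ * ‖f‖) / ‖φ z‖ := by
          gcongr
          exact (evalCLM z).le_opNorm_of_le (T.le_opNorm f)
      _ = ‖evalCLM z‖ * ‖T‖ / ‖φ z‖ * ‖f‖ := by ring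
  rw [le_div_iff₀ hφ] at hle
  exact le_of_mul_le_mul_left hle hpos

section TaylorIsometry

variable {E : Type*} [NormedAddCommGroup E] [InnerProductSpace ℂ E] [CompleteSpace E] {v : ℕ → E}

/-- The isometry sending the monomial `zⁿ` to the `n`-th term of an orthonormal sequence. -/
def taylorIsometry (hv : Orthonormal ℂ v) : HardyTwo →ₗᵢ[ℂ] E :=
  hv.orthogonalFamily.linearIsometry.comp monomialBasis.repr.toLinearIsometry

theorem hasSum_taylorIsometry (hv : Orthonormal ℂ v) (f : HardyTwo) :
    HasSum (fun n => taylorCoeff f.toFun n • v n) (taylorIsometry hv f) :=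
  hv.orthogonalFamily.hasSum_linearIsometry (monomialBasis.repr f)

theorem taylorIsometry_mem (hv : Orthonormal ℂ v) {K : Submodule ℂ E} (hK : IsClosed (K : Set E))
    (h : ∀ n, v n ∈ K) (f : HardyTwo) : taylorIsometry hv f ∈ K :=
  hK.mem_of_tendsto (hasSum_taylorIsometry hv f) <|
    .of_forall fun _ => K.sum_mem fun n _ => K.smul_mem _ (h n)

theorem inner_taylorIsometry_eq_zero {w : ℕ → E} (hv : Orthonormal ℂ v) (hw : Orthonormal ℂ w)
    (h : ∀ n m, inner ℂ (v n) (w m) = 0) (f g : HardyTwo) :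
    inner ℂ (taylorIsometry hv f) (taylorIsometry hw g) = 0 := by
  rw [← Submodule.mem_orthogonal_singleton_iff_inner_right]
  refine taylorIsometry_mem hw (Submodule.isClosed_orthogonal _) (fun m => ?_) g
  rw [Submodule.mem_orthogonal_singleton_iff_inner_right,
    ← Submodule.mem_orthogonal_singleton_iff_inner_left]
  refine taylorIsometry_mem hv (Submodule.isClosed_orthogonal _) (fun n => ?_) f
  exact (Submodule.mem_orthogonal_singleton_iff_inner_left).2 (h n m)

end TaylorIsometry

theorem toFun_taylorIsometry {v : ℕ → HardyTwo} (hv : Orthonormal ℂ v) {φ : 𝔻 → ℂ}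
    (hφ : ∀ n z, (v n).toFun z = φ z * (z : ℂ) ^ n) (f : HardyTwo) :
    (taylorIsometry hv f).toFun = φ * f.toFun := by
  ext z
  refine ((hasSum_taylorIsometry hv f).mapL (evalCLM z)).unique ?_
  convert! (f.hasSum_toFun z).mul_left (φ z) using 2 with n
  rw [map_smul, evalCLM_apply, hφ, smul_eq_mul, mul_left_comm]

/-- Multiplication by the coordinate, as a linear isometry. -/
def shift : HardyTwo →ₗᵢ[ℂ] HardyTwo :=
  taylorIsometry (monomialBasis.orthonormal.comp Nat.succ Nat.succ_injective)

theorem shift_apply (f : HardyTwo) : shift f = coordZ • f :=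
  toFun_injective <| toFun_taylorIsometry _
    (fun n z => (monomialBasis_toFun (n + 1) z).trans (pow_succ' _ n)) f

theorem toFun_shift_iterate (n : ℕ) (f : HardyTwo) (z : 𝔻) :
    (shift^[n] f).toFun z = f.toFun z * (z : ℂ) ^ n := by
  induction n with
  | zero => simp
  | succ n ih =>
    rw [Function.iterate_succ_apply', shift_apply, pow_succ', mul_left_comm, ← ih]
    rfl

/-! ### Order of vanishing at the origin -/

theorem eq_zero_of_forall_le_ord {f : HardyTwo} (h : ∀ n : ℕ, (n : ℕ∞) ≤ f.ord) : f = 0 := by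
  apply toSeq_injective
  ext n
  rw [toSeq_apply, (f.analytic.le_discOrd_iff (n + 1)).1 (h (n + 1)) n n.lt_succ_self, map_zero]
  rfl

theorem ord_shift (f : HardyTwo) : (shift f).ord = f.ord + 1 := by
  have hz : discOrd coordZ.1 = 1 := by
    have h : discExt coordZ.1 =ᶠ[𝓝 0] fun z => z - 0 := by
      filter_upwards [Metric.ball_mem_nhds (0 : ℂ) one_pos] with z hz
      rw [sub_zero]
      exact discExt_of id hz
    rw [discOrd, analyticOrderAt_congr h, analyticOrderAt_id_sub_const_self]
  rw [shift_apply, ord, toFun_hsmul, discOrd, discExt_mul,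
    analyticOrderAt_mul (AnalyticOnDisc.analyticAt coordZ.2.1) f.analytic.analyticAt, add_comm]
  exact congrArg (f.ord + ·) hz

theorem eq_bot_of_le_map_shift {V : Submodule ℂ HardyTwo}
    (hV : V ≤ V.map shift.toLinearMap) : V = ⊥ := by
  have hord (n : ℕ) : ∀ f ∈ V, (n : ℕ∞) ≤ f.ord := by
    induction n with
    | zero => simp
    | succ n ih =>
      intro f hf
      obtain ⟨g, hg, rfl⟩ := hV hf
      change _ ≤ (shift g).ord
      rw [ord_shift, Nat.cast_succ]
      exact add_le_add_left (ih g hg) 1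
  exact (Submodule.eq_bot_iff V).2 fun f hf => eq_zero_of_forall_le_ord fun n => hord n f hf

end HardyTwo

/-! ### Invariance of near inner decompositions -/

section NearInner

variable {R : Subalgebra ℂ HInfty} {V : Submodule ℂ HardyTwo}

theorem mem_valSub {k : ℕ} {h : HardyTwo} : h ∈ valSub V k ↔ h ∈ V ∧ (k : ℕ∞) ≤ h.ord := Iff.rfl

theorem nearHomComp_le (V : Submodule ℂ HardyTwo) (k : ℕ) : nearHomComp V k ≤ V :=
  fun _ hx => hx.1.1

theorem valSub_succ_le (V : Submodule ℂ HardyTwo) (k : ℕ) : valSub V (k + 1) ≤ valSub V k :=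
  fun _ hx => ⟨hx.1, le_trans (by exact_mod_cast k.le_succ) hx.2⟩

theorem isClosed_valSub (hV : IsClosed (V : Set HardyTwo)) (k : ℕ) :
    IsClosed (valSub V k : Set HardyTwo) := by
  convert hV.inter (isClosed_valSub_top k) using 1
  ext h
  simp [mem_valSub]

theorem mem_valSub_succ (hV : IsClosed (V : Set HardyTwo)) {k : ℕ} {x : HardyTwo}
    (hx : x ∈ valSub V k) (hxW : x ∈ (nearHomComp V k)ᗮ) : x ∈ valSub V (k + 1) := by
  have := (isClosed_valSub hV (k + 1)).completeSpace_coe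
  exact mem_of_mem_orthogonal_inf_orthogonal (valSub_succ_le V k) hx hxW

theorem mem_valSub_of_forall_lt (hV : IsClosed (V : Set HardyTwo)) {k : ℕ} {x : HardyTwo}
    (hx : x ∈ V) (hxW : ∀ i < k, x ∈ (nearHomComp V i)ᗮ) : x ∈ valSub V k := by
  induction k with
  | zero => exact ⟨hx, by simp⟩
  | succ k ih => exact mem_valSub_succ hV (ih fun i hi => hxW i (by omega)) (hxW k k.lt_succ_self)

theorem topologicalClosure_iSup_nearHomComp (hV : IsClosed (V : Set HardyTwo)) :
    (⨆ k, nearHomComp V k).topologicalClosure = V := by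
  have hle := Submodule.topologicalClosure_minimal _ (iSup_le (nearHomComp_le V)) hV
  have := (Submodule.isClosed_topologicalClosure (⨆ k, nearHomComp V k)).completeSpace_coe
  refine le_antisymm hle fun x hx => mem_of_mem_orthogonal_inf_orthogonal hle hx ?_
  have hbot : V ⊓ (⨆ k, nearHomComp V k).topologicalClosureᗮ = ⊥ := by
    refine (Submodule.eq_bot_iff _).2 fun x hx => HardyTwo.eq_zero_of_forall_le_ord fun m => ?_
    refine (mem_valSub_of_forall_lt hV hx.1 fun i _ => Submodule.orthogonal_le ?_ hx.2).2
    exact (le_iSup (nearHomComp V) i).trans (Submodule.le_topologicalClosure _)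
  rw [hbot, Submodule.bot_orthogonal_eq_top]
  trivial

theorem succ_le_ord_sub_of_homProj_eq {m : ℕ} {x y : HardyTwo} (hx : (m : ℕ∞) ≤ x.ord)
    (hy : (m : ℕ∞) ≤ y.ord) (h : homProj m x = homProj m y) :
    ((m + 1 : ℕ) : ℕ∞) ≤ (x - y).ord := by
  have hxy : x - y ∈ valSub ⊤ m := sub_mem (mem_valSub.2 ⟨trivial, hx⟩) (mem_valSub.2 ⟨trivial, hy⟩)
  refine (mem_valSub_succ isClosed_univ hxy ?_).2
  rw [← Submodule.starProjection_apply_eq_zero_iff]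
  change homProj m (x - y) = 0
  rw [map_sub, h, sub_self]

theorem exists_mem_le_ord_sub (hF : HasFullProjection R V) {k : ℕ} {h : HardyTwo}
    (hh : h ∈ nearHomComp V k) {r : HInfty} (hr : r ∈ R) (hr1 : 1 ≤ hInftyOrd r) (m : ℕ) :
    ∃ s ∈ V, (m : ℕ∞) ≤ (r • h - s).ord := by
  induction m with
  | zero => exact ⟨0, V.zero_mem, by simp⟩
  | succ m ih =>
    obtain ⟨s, hs, hm⟩ := ih
    rw [sub_eq_add_neg] at hm
    obtain ⟨w, hw, hwe⟩ := hF k m r hr hr1 h hh (-s) (V.neg_mem hs) hm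
    refine ⟨s + w, V.add_mem hs (nearHomComp_le V m hw), ?_⟩
    rw [sub_add_eq_sub_sub, sub_eq_add_neg (r • h)]
    exact succ_le_ord_sub_of_homProj_eq hm hw.1.2 hwe.symm

theorem le_ord_sub_starProjection [V.HasOrthogonalProjection]
    {m : ℕ} {x s : HardyTwo} (hs : s ∈ V) (hm : (m : ℕ∞) ≤ (x - s).ord)
    (horth : ∀ i < m, x - s ∈ (nearHomComp V i)ᗮ) :
    (m : ℕ∞) ≤ (x - V.starProjection x).ord := by
  have hV : IsClosed (V : Set HardyTwo) := V.orthogonal_orthogonal ▸ Vᗮ.isClosed_orthogonal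
  have hproj : V.starProjection x - s ∈ valSub V m := by
    refine mem_valSub_of_forall_lt hV (V.sub_mem (V.starProjection_apply_mem _) hs) fun i hi => ?_
    rw [← sub_sub_sub_cancel_left _ _ x]
    exact sub_mem (horth i hi)
      (Submodule.orthogonal_le (nearHomComp_le V i) (V.sub_starProjection_mem_orthogonal x))
  rw [← sub_sub_sub_cancel_right x _ s]
  exact (sub_mem (mem_valSub.2 ⟨trivial, hm⟩) (mem_valSub.2 ⟨trivial, hproj.2⟩) :
    _ ∈ valSub ⊤ m).2

theorem smul_mem_of_mem_nearHomComp (hV : IsClosed (V : Set HardyTwo)) (hN : IsNearInner R V)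
    (hF : HasFullProjection R V) {k : ℕ} {h : HardyTwo} (hh : h ∈ nearHomComp V k) {r : HInfty}
    (hr : r ∈ R) (hr1 : 1 ≤ hInftyOrd r) : r • h ∈ V := by
  have := hV.completeSpace_coe
  suffices r • h - V.starProjection (r • h) = 0 by
    rw [sub_eq_zero.1 this]
    exact V.starProjection_apply_mem _
  refine HardyTwo.eq_zero_of_forall_le_ord fun m => ?_
  obtain ⟨s, hs, hm⟩ := exists_mem_le_ord_sub hF hh hr hr1 m
  refine le_ord_sub_starProjection hs hm fun i hi => ?_
  rw [sub_eq_add_neg] at hm ⊢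
  exact hN k i h hh (-s) (V.neg_mem hs) r hr hr1 (lt_of_lt_of_le (by exact_mod_cast hi) hm)

theorem smul_mem_of_isNearInner (hV : IsClosed (V : Set HardyTwo)) (hN : IsNearInner R V)
    (hF : HasFullProjection R V) {r : HInfty} (hr : r ∈ R) (hr1 : 1 ≤ hInftyOrd r) {h : HardyTwo}
    (hh : h ∈ V) : r • h ∈ V := by
  have hclosed : IsClosed (V.comap (HardyTwo.mulCLM r).toLinearMap : Set HardyTwo) :=
    hV.preimage (HardyTwo.mulCLM r).continuous
  rw [← topologicalClosure_iSup_nearHomComp hV] at hh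
  exact Submodule.topologicalClosure_minimal _ (iSup_le fun k x hx =>
    smul_mem_of_mem_nearHomComp hV hN hF hx hr hr1) hclosed hh

theorem one_le_hInftyOrd {r : HInfty} (hr : r.1 0 = 0) : 1 ≤ hInftyOrd r := by
  refine Order.one_le_iff_ne_zero.2 fun h => ?_
  rw [hInftyOrd, discOrd, (AnalyticOnDisc.analyticAt r.2.1).analyticOrderAt_eq_zero] at h
  exact h ((discExt_coe r.1 0).trans hr)

theorem isInvariantUnder_of_isNearInner (hV : IsClosed (V : Set HardyTwo)) (hN : IsNearInner R V)
    (hF : HasFullProjection R V) : IsInvariantUnder R V := by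
  intro r hr h hh
  let c : HInfty := algebraMap ℂ HInfty (r.1 0)
  have hord : 1 ≤ hInftyOrd (r - c) := one_le_hInftyOrd (sub_self (r.1 0))
  have hsub : (r - c) • h ∈ V :=
    smul_mem_of_isNearInner hV hN hF (R.sub_mem hr (R.algebraMap_mem _)) hord hh
  rw [sub_smul] at hsub
  exact (V.sub_mem_iff_left (V.smul_mem (r.1 0) hh)).1 hsub

end NearInner

/-! ### Closed subspaces invariant under the shift -/

namespace HardyTwo

variable {V : Submodule ℂ HardyTwo}

theorem exists_norm_eq_one_inner_shift_eq_zero (hV : IsClosed (V : Set HardyTwo)) (hne : V ≠ ⊥)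
    (hS : Set.MapsTo shift V V) : ∃ φ ∈ V, ‖φ‖ = 1 ∧ ∀ f ∈ V, inner ℂ φ (shift f) = 0 := by
  have := hV.completeSpace_coe
  have : CompleteSpace (V.map shift.toLinearMap) := shift.completeSpace_map V
  have hle : V.map shift.toLinearMap ≤ V := Submodule.map_le_iff_le_comap.2 hS
  obtain ⟨g, hg, hg0⟩ := (V ⊓ (V.map shift.toLinearMap)ᗮ).ne_bot_iff.1 fun hbot =>
    hne <| eq_bot_of_le_map_shift fun x hx => mem_of_mem_orthogonal_inf_orthogonal hle hx <| by
      rw [hbot, Submodule.bot_orthogonal_eq_top]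
      trivial
  refine ⟨(‖g‖⁻¹ : ℂ) • g, V.smul_mem _ hg.1, norm_smul_inv_norm hg0, fun f hf => ?_⟩
  have hgf : inner ℂ (shift f) g = 0 := hg.2 _ (Submodule.mem_map_of_mem hf)
  rw [inner_smul_left, inner_eq_zero_symm.1 hgf, mul_zero]

-- Otherwise `φψ`, which lies in the closed span of both orbits, would be orthogonal to itself.
theorem exists_inner_shift_iterate_ne_zero {φ ψ : HardyTwo}
    (hφ : Orthonormal ℂ fun n => shift^[n] φ) (hψ : Orthonormal ℂ fun n => shift^[n] ψ) :
    ∃ n m, inner ℂ (shift^[n] φ) (shift^[m] ψ) ≠ 0 := by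
  by_contra! horth
  have hprod : taylorIsometry hφ ψ = taylorIsometry hψ φ := toFun_injective <| by
    rw [toFun_taylorIsometry hφ fun n z => toFun_shift_iterate n φ z,
      toFun_taylorIsometry hψ fun n z => toFun_shift_iterate n ψ z, mul_comm]
  have hzero : taylorIsometry hφ ψ = 0 := by
    rw [← inner_self_eq_zero (𝕜 := ℂ)]
    nth_rw 2 [hprod]
    exact inner_taylorIsometry_eq_zero hφ hψ horth ψ φ
  have hnorm : ‖taylorIsometry hφ ψ‖ = 1 := (taylorIsometry hφ).norm_map ψ |>.trans (hψ.1 0)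
  simp [hzero] at hnorm

theorem inf_orthogonal_span_shift_iterate_eq_bot (hV : IsClosed (V : Set HardyTwo))
    (hS : Set.MapsTo shift V V) {φ : HardyTwo} (hφ : Orthonormal ℂ fun n => shift^[n] φ)
    (hφV : ∀ f ∈ V, inner ℂ φ (shift f) = 0) :
    V ⊓ (Submodule.span ℂ (Set.range fun n => shift^[n] φ))ᗮ = ⊥ := by
  set N := V ⊓ (Submodule.span ℂ (Set.range fun n => shift^[n] φ))ᗮ
  have hNS : Set.MapsTo shift N N := by
    refine fun g hg => ⟨hS hg.1, mem_orthogonal_span_range_iff.2 fun n => ?_⟩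
    cases n with
    | zero => exact hφV g hg.1
    | succ n =>
      rw [Function.iterate_succ_apply', shift.inner_map_map]
      exact mem_orthogonal_span_range_iff.1 hg.2 n
  have hNclosed : IsClosed (N : Set HardyTwo) := hV.inter (Submodule.isClosed_orthogonal _)
  by_contra hne
  obtain ⟨ψ, hψ, hψ1, hψN⟩ := exists_norm_eq_one_inner_shift_eq_zero hNclosed hne hNS
  have hφψ (n : ℕ) : inner ℂ (shift^[n] φ) ψ = 0 := mem_orthogonal_span_range_iff.1 hψ.2 n
  have hψφ (n : ℕ) : inner ℂ (shift^[n] ψ) φ = 0 := by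
    cases n with
    | zero => exact inner_eq_zero_symm.1 (hφψ 0)
    | succ n =>
      rw [Function.iterate_succ_apply', inner_eq_zero_symm]
      exact hφV _ (hS.iterate n hψ.1)
  have hψorth : Orthonormal ℂ fun n => shift^[n] ψ := orthonormal_iterate shift hψ1 fun n => by
    rw [Function.iterate_succ_apply']
    exact hψN _ (hNS.iterate n hψ)
  obtain ⟨n, m, hnm⟩ := exists_inner_shift_iterate_ne_zero hφ hψorth
  exact hnm (inner_iterate_iterate_eq_zero shift hφψ hψφ n m)

theorem exists_hInfty_smul_eq_taylorIsometry {φ : HardyTwo}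
    (hφ : Orthonormal ℂ fun n => shift^[n] φ) :
    ∃ J : HInfty, ∀ f : HardyTwo, J • f = taylorIsometry hφ f := by
  have hT (f : HardyTwo) : (taylorIsometry hφ f).toFun = φ.toFun * f.toFun :=
    toFun_taylorIsometry hφ (fun n z => toFun_shift_iterate n φ z) f
  exact ⟨⟨φ.toFun, φ.analytic, _, norm_le_of_toFun_eq_mul (taylorIsometry hφ).toContinuousLinearMap
    hT⟩, fun f => toFun_injective (hT f).symm⟩

theorem isClosed_mulHardy {J : HInfty} (hJ : ∀ f : HardyTwo, ‖J • f‖ = ‖f‖) :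
    IsClosed (mulHardy J : Set HardyTwo) := by
  have hiso : Isometry (mulCLM J) := AddMonoidHomClass.isometry_of_norm _ hJ
  convert hiso.isClosedEmbedding.isClosed_range
  ext h
  exact exists_congr fun f => eq_comm

theorem exists_eq_mulHardy_of_mapsTo_shift (hV : IsClosed (V : Set HardyTwo)) (hne : V ≠ ⊥)
    (hS : Set.MapsTo shift V V) :
    ∃ J : HInfty, (∀ f : HardyTwo, ‖J • f‖ = ‖f‖) ∧ V = mulHardy J := by
  obtain ⟨φ, hφV, hφ1, hφ0⟩ := exists_norm_eq_one_inner_shift_eq_zero hV hne hS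
  have hφ : Orthonormal ℂ fun n => shift^[n] φ := orthonormal_iterate shift hφ1 fun n => by
    rw [Function.iterate_succ_apply']
    exact hφ0 _ (hS.iterate n hφV)
  obtain ⟨J, hJ⟩ := exists_hInfty_smul_eq_taylorIsometry hφ
  have hnorm (f : HardyTwo) : ‖J • f‖ = ‖f‖ := by rw [hJ, LinearIsometry.norm_map]
  have hle : mulHardy J ≤ V := by
    rintro _ ⟨f, rfl⟩
    rw [hJ]
    exact taylorIsometry_mem hφ hV (fun n => hS.iterate n hφV) f
  have horbit (n : ℕ) : shift^[n] φ ∈ mulHardy J := by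
    refine ⟨monomialBasis n, toFun_injective ?_⟩
    ext z
    rw [hJ, toFun_taylorIsometry hφ fun n z => toFun_shift_iterate n φ z, toFun_shift_iterate,
      Pi.mul_apply, monomialBasis_toFun]
  have := (isClosed_mulHardy hnorm).completeSpace_coe
  refine ⟨J, hnorm, le_antisymm (fun x hx => mem_of_mem_orthogonal_inf_orthogonal hle hx ?_) hle⟩
  have hbot : V ⊓ (mulHardy J)ᗮ ≤ ⊥ := by
    rw [← inf_orthogonal_span_shift_iterate_eq_bot hV hS hφ hφ0]
    exact inf_le_inf_left V
      (Submodule.orthogonal_le (Submodule.span_le.2 (Set.range_subset_iff.2 horbit)))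
  rw [le_bot_iff.1 hbot, Submodule.bot_orthogonal_eq_top]
  trivial

end HardyTwo

/-! ### Fatou's theorem on radial limits -/

section Fatou

open Metric InnerProductSpace

theorem norm_circleAverage_le_of_norm_le {F : ℂ → ℂ} {B : ℂ → ℝ} {c : ℂ} {R : ℝ}
    (hB : CircleIntegrable B c R) (h : ∀ z ∈ sphere c |R|, ‖F z‖ ≤ B z) :
    ‖Real.circleAverage F c R‖ ≤ Real.circleAverage B c R := by
  rw [Real.circleAverage_def, Real.circleAverage_def, norm_smul, smul_eq_mul,
    Real.norm_of_nonneg (by positivity)]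
  gcongr
  exact intervalIntegral.norm_integral_le_of_norm_le (by positivity)
    (.of_forall fun θ _ => h _ (circleMap_mem_sphere' c R θ)) hB

theorem deriv_eq_circleIntegral_of_diffContOnCl {e : ℂ → ℂ} {c z : ℂ} {R : ℝ}
    (he : DiffContOnCl ℂ e (ball c R)) (hz : z ∈ ball c R) :
    deriv e z = (2 * Real.pi * I : ℂ)⁻¹ • ∮ ζ in C(c, R), ((ζ - z) ^ 2)⁻¹ • e ζ := by
  have hR := pos_of_mem_ball hz
  have hnhds : ball c R ∈ 𝓝 z := isOpen_ball.mem_nhds hz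
  have hdslope : DiffContOnCl ℂ (dslope e z) (ball c R) :=
    ⟨(differentiableOn_dslope hnhds).2 he.1, (continuousOn_dslope (mem_of_superset hnhds
      subset_closure)).2 ⟨he.2, he.1.differentiableAt hnhds⟩⟩
  have hne {ζ : ℂ} (hζ : ζ ∈ sphere c R) : ζ ≠ z := sphere_disjoint_ball.ne_of_mem hζ hz
  have hker : ContinuousOn (fun ζ : ℂ => ((ζ - z) ^ 2)⁻¹) (sphere c R) :=
    ContinuousOn.inv₀ (by fun_prop) fun ζ hζ => pow_ne_zero 2 (sub_ne_zero.2 (hne hζ))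
  have hint0 : (∮ ζ in C(c, R), ((ζ - z) ^ 2)⁻¹ • e z) = 0 := by
    have h := circleIntegral.integral_sub_zpow_of_ne (by decide : (-2 : ℤ) ≠ -1) c z R
    rw [circleIntegral.integral_smul_const]
    simp_all [zpow_neg]
  have hsub := circleIntegral.integral_sub
    ((hker.smul (he.continuousOn_ball.mono sphere_subset_closedBall)).circleIntegrable hR.le)
    ((hker.smul (continuousOn_const (c := e z))).circleIntegrable hR.le)
  rw [← dslope_same e z, ← hdslope.two_pi_i_inv_smul_circleIntegral_sub_inv_smul hz]
  congr 1
  refine .trans (circleIntegral.integral_congr hR.le fun ζ hζ => ?_)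
    (hsub.trans ((congrArg _ hint0).trans (sub_zero _)))
  simp only [dslope_of_ne _ (hne hζ), slope, vsub_eq_sub, Pi.smul_apply', smul_eq_mul]
  rw [sq, mul_inv]
  ring

theorem deriv_eq_circleAverage_of_diffContOnCl {e : ℂ → ℂ} {z w : ℂ}
    (he : DiffContOnCl ℂ e (ball 0 1)) (hz : z ∈ ball (0 : ℂ) 1) (hw : 1 < ‖w‖) :
    deriv e z =
      Real.circleAverage (fun ζ => ζ * ((((ζ - z) ^ 2)⁻¹ - ((ζ - w) ^ 2)⁻¹) * e ζ)) 0 1 := by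
  have hne {a : ℂ} {s : Set ℂ} (ha : a ∉ s) :
      ∀ ζ ∈ s, (ζ - a) ^ 2 ≠ 0 := fun ζ hζ =>
    pow_ne_zero 2 (sub_ne_zero.2 (ne_of_mem_of_not_mem hζ ha))
  have hw' : w ∉ closedBall (0 : ℂ) 1 := by simpa using hw
  have hcw : ContinuousOn (fun ζ => ((ζ - w) ^ 2)⁻¹ * e ζ) (closedBall 0 1) :=
    (ContinuousOn.inv₀ (by fun_prop) (hne hw')).mul he.continuousOn_ball
  have hcz : ContinuousOn (fun ζ => ((ζ - z) ^ 2)⁻¹ * e ζ) (sphere 0 1) :=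
    (ContinuousOn.inv₀ (by fun_prop) (hne (sphere_disjoint_ball.notMem_of_mem_right hz))).mul
      (he.continuousOn_ball.mono sphere_subset_closedBall)
  have hw0 : (∮ ζ in C(0, 1), ((ζ - w) ^ 2)⁻¹ * e ζ) = 0 := by
    refine DiffContOnCl.circleIntegral_eq_zero zero_le_one ⟨?_, ?_⟩
    · exact (DifferentiableOn.inv (by fun_prop)
        fun ζ hζ => hne hw' ζ (ball_subset_closedBall hζ)).mul he.1
    · rwa [closure_ball _ one_ne_zero]
  rw [Real.circleAverage_eq_circleIntegral one_ne_zero,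
    deriv_eq_circleIntegral_of_diffContOnCl he hz]
  simp only [smul_eq_mul]
  congr 1
  refine .trans ((sub_zero _).symm.trans (congrArg _ hw0.symm)) ?_
  rw [← circleIntegral.integral_sub (hcz.circleIntegrable zero_le_one)
    ((hcw.mono sphere_subset_closedBall).circleIntegrable zero_le_one)]
  refine circleIntegral.integral_congr zero_le_one fun ζ hζ => ?_
  simp only [sub_zero]
  rw [inv_mul_cancel_left₀ (ne_of_mem_sphere hζ one_ne_zero), sub_mul]

theorem norm_ofReal_mul_of_norm_eq_one {ζ : ℂ} (hζ : ‖ζ‖ = 1) {r : ℝ} (hr : 0 ≤ r) :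
    ‖r * ζ‖ = r := by
  rw [norm_mul, hζ, norm_real, Real.norm_of_nonneg hr, mul_one]

theorem norm_sub_inv_mul {ζ ζ₀ : ℂ} (hζ : ‖ζ‖ = 1) (hζ₀ : ‖ζ₀‖ = 1) {r : ℝ} (hr : 0 < r) :
    ‖ζ - (r : ℂ)⁻¹ * ζ₀‖ = ‖ζ - r * ζ₀‖ / r := by
  have hsq : ‖r * ζ - ζ₀‖ = ‖ζ - r * ζ₀‖ := by
    rw [← sq_eq_sq₀ (norm_nonneg _) (norm_nonneg _), @norm_sub_sq_real ℂ, @norm_sub_sq_real ℂ,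
      norm_mul, norm_mul, hζ, hζ₀, norm_real, ← real_smul, ← real_smul,
      real_inner_smul_left, real_inner_smul_right]
    ring
  have hr' : (r : ℂ) ≠ 0 := ofReal_ne_zero.2 hr.ne'
  rw [← hsq, show ζ - (r : ℂ)⁻¹ * ζ₀ = (r * ζ - ζ₀) / r by field_simp, norm_div, norm_real,
    Real.norm_of_nonneg hr.le]

theorem norm_sub_le_two_mul_norm_sub {ζ ζ₀ : ℂ} (hζ : ‖ζ‖ = 1) (hζ₀ : ‖ζ₀‖ = 1) {r : ℝ}
    (hr : 0 ≤ r) (hr1 : r ≤ 1) : ‖ζ - ζ₀‖ ≤ 2 * ‖ζ - r * ζ₀‖ := by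
  have hradial : ‖r * ζ₀ - ζ₀‖ = 1 - r := by
    rw [← sub_one_mul, ← ofReal_one, ← ofReal_sub, norm_mul, hζ₀, mul_one, norm_real,
      Real.norm_of_nonpos (sub_nonpos.2 hr1), neg_sub]
  have hlower := norm_sub_norm_le ζ (r * ζ₀)
  rw [hζ, norm_ofReal_mul_of_norm_eq_one hζ₀ hr] at hlower
  linarith [norm_sub_le_norm_sub_add_norm_sub ζ (r * ζ₀) ζ₀]

theorem norm_inv_sq_sub_inv_sq_mul_le {ζ ζ₀ : ℂ} (hζ : ‖ζ‖ = 1) (hζ₀ : ‖ζ₀‖ = 1) {r : ℝ}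
    (hr : 0 < r) (hr1 : r < 1) :
    ‖((ζ - r * ζ₀) ^ 2)⁻¹ - ((ζ - (r : ℂ)⁻¹ * ζ₀) ^ 2)⁻¹‖ * ‖ζ - ζ₀‖ ≤
      4 * poissonKernel 0 (r * ζ₀) ζ := by
  have hrz := norm_ofReal_mul_of_norm_eq_one hζ₀ hr.le
  set z := r * ζ₀
  set w := (r : ℂ)⁻¹ * ζ₀
  have hwz : ‖ζ - w‖ = ‖ζ - z‖ / r := norm_sub_inv_mul hζ hζ₀ hr
  set d := ‖ζ - z‖
  have hd0 : 0 < d := by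
    have h := norm_sub_norm_le ζ z
    rw [hζ, hrz] at h
    linarith
  have hz0 : ζ - z ≠ 0 := norm_pos_iff.1 hd0
  have hw0 : ζ - w ≠ 0 := norm_pos_iff.1 (by rw [hwz]; positivity)
  have hnum : ‖z - w‖ = (1 - r ^ 2) / r := by
    rw [← sub_mul, ← ofReal_inv, ← ofReal_sub, norm_mul, hζ₀, mul_one, norm_real,
      Real.norm_of_nonpos (sub_nonpos.2 (hr1.le.trans (one_le_inv₀ hr |>.2 hr1.le)))]
    field_simp
    ring
  have hr2 : 0 ≤ 1 - r ^ 2 := by nlinarith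
  have hdist : ‖ζ - ζ₀‖ ≤ 2 * d := norm_sub_le_two_mul_norm_sub hζ hζ₀ hr.le hr1.le
  calc ‖((ζ - z) ^ 2)⁻¹ - ((ζ - w) ^ 2)⁻¹‖ * ‖ζ - ζ₀‖
      = ‖z - w‖ * ‖(ζ - z) + (ζ - w)‖ / (d ^ 2 * ‖ζ - w‖ ^ 2) * ‖ζ - ζ₀‖ := by
        rw [inv_sub_inv (pow_ne_zero 2 hz0) (pow_ne_zero 2 hw0), norm_div,
          norm_mul ((ζ - z) ^ 2), norm_pow, norm_pow, ← norm_mul (z - w)]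
        congr 3
        ring
    _ ≤ (1 - r ^ 2) / r * (d + d / r) / (d ^ 2 * (d / r) ^ 2) * (2 * d) := by
        rw [hnum, hwz]
        gcongr
        exact (norm_add_le _ _).trans_eq (by rw [hwz])
    _ = 2 * (1 + r) * ((1 - r ^ 2) / d ^ 2) := by field_simp; ring
    _ ≤ 4 * ((1 - r ^ 2) / d ^ 2) := by gcongr; linarith
    _ = 4 * poissonKernel 0 z ζ := by
        rw [poissonKernel_def, sub_zero, sub_zero, hζ, hrz, one_pow]

theorem norm_deriv_le_of_norm_le_harmonic {e : ℂ → ℂ} {u : ℂ → ℝ} {ζ₀ : ℂ} {r : ℝ}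
    (he : DiffContOnCl ℂ e (ball 0 1)) (hu : HarmonicOnNhd u (closedBall 0 1)) (hζ₀ : ‖ζ₀‖ = 1)
    (hr : 0 < r) (hr1 : r < 1) (h : ∀ ζ ∈ sphere (0 : ℂ) 1, ‖e ζ‖ ≤ u ζ * ‖ζ - ζ₀‖)
    (hu0 : ∀ ζ ∈ sphere (0 : ℂ) 1, 0 ≤ u ζ) :
    ‖deriv e (r * ζ₀)‖ ≤ 4 * u (r * ζ₀) := by
  have hz : r * ζ₀ ∈ ball (0 : ℂ) 1 := by
    rwa [mem_ball_zero_iff, norm_ofReal_mul_of_norm_eq_one hζ₀ hr.le]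
  have hw : 1 < ‖(r : ℂ)⁻¹ * ζ₀‖ := by
    rw [← ofReal_inv, norm_ofReal_mul_of_norm_eq_one hζ₀ (inv_pos.2 hr).le]
    exact (one_lt_inv₀ hr).2 hr1
  have hP : ContinuousOn (poissonKernel 0 (r * ζ₀)) (sphere 0 |1|) := by
    rw [poissonKernel_eq_re_herglotzRieszKernel]
    exact continuous_re.comp_continuousOn (continuousOn_herglotzRieszKernel_sphere hz)
  have hPu : ContinuousOn (fun ζ => 4 * (poissonKernel 0 (r * ζ₀) ζ * u ζ)) (sphere 0 |1|) :=
    continuousOn_const.mul (hP.mul fun ζ hζ =>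
      (hu ζ (sphere_subset_closedBall (by simpa using hζ))).1.continuousAt.continuousWithinAt)
  have hpoisson := hu.circleAverage_poissonKernel_smul hz
  rw [deriv_eq_circleAverage_of_diffContOnCl he hz hw, ← hpoisson, ← smul_eq_mul (4 : ℝ),
    ← Real.circleAverage_fun_smul]
  refine norm_circleAverage_le_of_norm_le hPu.circleIntegrable' fun ζ hζ => ?_
  rw [abs_one] at hζ
  have hζ1 : ‖ζ‖ = 1 := mem_sphere_zero_iff_norm.1 hζ
  rw [norm_mul, hζ1, one_mul, norm_mul]
  have hK := norm_inv_sq_sub_inv_sq_mul_le hζ1 hζ₀ hr hr1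
  set K := ‖((ζ - r * ζ₀) ^ 2)⁻¹ - ((ζ - (r : ℂ)⁻¹ * ζ₀) ^ 2)⁻¹‖
  calc K * ‖e ζ‖ ≤ K * (u ζ * ‖ζ - ζ₀‖) := mul_le_mul_of_nonneg_left (h ζ hζ) (norm_nonneg _)
    _ = K * ‖ζ - ζ₀‖ * u ζ := by ring
    _ ≤ 4 * poissonKernel 0 (r * ζ₀) ζ * u ζ := mul_le_mul_of_nonneg_right hK (hu0 ζ hζ)
    _ = (4 : ℝ) • (poissonKernel 0 (r * ζ₀) • u) ζ := mul_assoc _ _ _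

theorem exists_norm_le_of_isLittleO {s : Set ℂ} (hs : IsCompact s) {e : ℂ → ℂ} {ζ₀ : ℂ}
    (he : ContinuousOn e s) (ho : e =o[𝓝[s] ζ₀] fun ζ => ζ - ζ₀) {ε : ℝ} (hε : 0 < ε) :
    ∃ M, 0 ≤ M ∧ ∀ ζ ∈ s, ‖e ζ‖ ≤ (ε + M * ‖ζ - ζ₀‖ ^ 2) * ‖ζ - ζ₀‖ := by
  obtain ⟨D, hD⟩ := hs.exists_bound_of_continuousOn he
  obtain ⟨δ, hδ, hnear⟩ := mem_nhdsWithin_iff.1 (ho.def hε)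
  refine ⟨|D| / δ ^ 3, by positivity, fun ζ hζ => ?_⟩
  rcases lt_or_ge ‖ζ - ζ₀‖ δ with hlt | hge
  · refine (hnear ⟨mem_ball_iff_norm.2 hlt, hζ⟩).trans ?_
    gcongr
    exact le_add_of_nonneg_right (by positivity)
  · calc ‖e ζ‖ ≤ |D| := (hD ζ hζ).trans (le_abs_self D)
      _ = |D| / δ ^ 3 * δ ^ 3 := by field_simp
      _ ≤ |D| / δ ^ 3 * ‖ζ - ζ₀‖ ^ 3 := by gcongr
      _ ≤ ε * ‖ζ - ζ₀‖ + |D| / δ ^ 3 * ‖ζ - ζ₀‖ ^ 3 := le_add_of_nonneg_left (by positivity)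
      _ = _ := by ring

-- Korovkin's trick: on the circle, `‖ζ - ζ₀‖²` is the harmonic function `2 - 2 Re (ζ * conj ζ₀)`.
theorem exists_norm_deriv_le_of_isLittleO {e : ℂ → ℂ} {ζ₀ : ℂ}
    (he : DiffContOnCl ℂ e (ball 0 1)) (hζ₀ : ‖ζ₀‖ = 1)
    (ho : e =o[𝓝[sphere 0 1] ζ₀] fun ζ => ζ - ζ₀) {ε : ℝ} (hε : 0 < ε) :
    ∃ M, ∀ r ∈ Set.Ioo (0 : ℝ) 1, ‖deriv e (r * ζ₀)‖ ≤ 4 * (ε + M * (1 - r)) := by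
  obtain ⟨M, hM0, hM⟩ := exists_norm_le_of_isLittleO (isCompact_sphere (0 : ℂ) 1)
    (he.continuousOn_ball.mono sphere_subset_closedBall) ho hε
  let F : ℂ → ℂ := fun ζ => ε + (2 * M : ℝ) * (1 - ζ * conj ζ₀)
  have hF {ζ : ℂ} (hζ : ζ ∈ sphere (0 : ℂ) 1) : (F ζ).re = ε + M * ‖ζ - ζ₀‖ ^ 2 := by
    rw [Complex.sq_norm, normSq_sub, normSq_eq_norm_sq, normSq_eq_norm_sq, hζ₀,
      mem_sphere_zero_iff_norm.1 hζ]
    simp only [F, add_re, re_ofReal_mul, sub_re, ofReal_re, one_re]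
    ring
  refine ⟨2 * M, fun r hr => ?_⟩
  have h := norm_deriv_le_of_norm_le_harmonic (u := fun ζ => (F ζ).re) he
    (fun ζ _ => AnalyticAt.harmonicAt_re (by fun_prop)) hζ₀ hr.1 hr.2
    (fun ζ hζ => by simpa only [hF hζ] using hM ζ hζ) fun ζ hζ => by rw [hF hζ]; positivity
  have hFr : F (r * ζ₀) = (ε + 2 * M * (1 - r) : ℝ) := by
    simp only [F, mul_assoc, mul_conj', hζ₀]
    simp [mul_assoc]
  rwa [hFr, ofReal_re] at h

theorem tendsto_deriv_of_hasDerivWithinAt_sphere {g : ℂ → ℂ} {ζ₀ A : ℂ}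
    (hg : DiffContOnCl ℂ g (ball 0 1)) (hζ₀ : ‖ζ₀‖ = 1)
    (h : HasDerivWithinAt g A (sphere 0 1) ζ₀) :
    Tendsto (fun r : ℝ => deriv g (r * ζ₀)) (𝓝[<] 1) (𝓝 A) := by
  let e : ℂ → ℂ := fun ζ => g ζ - g ζ₀ - (ζ - ζ₀) • A
  have he : DiffContOnCl ℂ e (ball 0 1) := (hg.sub_const _).sub
    (((differentiable_id.sub_const ζ₀).smul_const A).diffContOnCl)
  have hderiv {r : ℝ} (hr : r ∈ Set.Ioo 0 1) : deriv g (r * ζ₀) - A = deriv e (r * ζ₀) := by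
    have hz : r * ζ₀ ∈ ball (0 : ℂ) 1 := by
      rw [mem_ball_zero_iff, norm_ofReal_mul_of_norm_eq_one hζ₀ hr.1.le]
      exact hr.2
    have hgz := (hg.differentiableAt isOpen_ball hz).hasDerivAt
    have hez := (hgz.sub_const (g ζ₀)).sub (((hasDerivAt_id _).sub_const ζ₀).smul_const A)
    rw [one_smul] at hez
    exact hez.deriv.symm
  rw [← tendsto_sub_nhds_zero_iff, NormedAddGroup.tendsto_nhds_zero]
  intro ε hε
  obtain ⟨M, hM⟩ := exists_norm_deriv_le_of_isLittleO he hζ₀ (hasDerivWithinAt_iff_isLittleO.1 h)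
    (show 0 < ε / 8 by positivity)
  have hbound : Tendsto (fun r : ℝ => 4 * (ε / 8 + M * (1 - r))) (𝓝[<] 1) (𝓝 (ε / 2)) := by
    refine (Continuous.tendsto' (by fun_prop) _ _ ?_).mono_left nhdsWithin_le_nhds
    ring
  filter_upwards [hbound.eventually_lt_const (half_lt_self hε), Ioo_mem_nhdsLT zero_lt_one]
    with r hlt hr
  rw [hderiv hr]
  exact (hM r hr).trans_lt hlt

theorem hasDerivWithinAt_sphere_of_hasDerivAt_comp_circleMap {g : ℂ → ℂ} {B : ℂ} {θ : ℝ}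
    (h : HasDerivAt (fun θ => g (circleMap 0 1 θ)) B θ) :
    HasDerivWithinAt g (B / (circleMap 0 1 θ * I)) (sphere 0 1) (circleMap 0 1 θ) := by
  set ζ₀ := circleMap 0 1 θ with hζ₀
  have hn0 : ‖ζ₀‖ = 1 := by simp [hζ₀]
  have hne : ζ₀ ≠ 0 := norm_ne_zero_iff.1 (by rw [hn0]; exact one_ne_zero)
  have hcircle : HasDerivAt (fun t => g (circleMap 0 1 t) - g ζ₀ -
      (circleMap 0 1 t - ζ₀) • (B / (ζ₀ * I))) 0 θ := by
    refine ((h.sub_const (g ζ₀)).sub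
      (((hasDerivAt_circleMap 0 1 θ).sub_const ζ₀).smul_const _)).congr_deriv ?_
    rw [smul_eq_mul, mul_div_cancel₀ _ (mul_ne_zero hne I_ne_zero), sub_self]
  let t : ℂ → ℝ := fun ζ => θ + (ζ / ζ₀).arg
  have ht {ζ : ℂ} (hζ : ζ ∈ sphere (0 : ℂ) 1) : circleMap 0 1 (t ζ) = ζ := by
    have hpolar := norm_mul_exp_arg_mul_I (ζ / ζ₀)
    rw [norm_div, mem_sphere_zero_iff_norm.1 hζ, hn0, div_one, ofReal_one, one_mul] at hpolar
    rw [circleMap_zero, ofReal_one, one_mul, ofReal_add, add_mul, exp_add, hpolar,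
      ← mul_div_cancel₀ ζ hne, hζ₀]
    simp [circleMap]
  have hO : (fun ζ => t ζ - θ) =O[𝓝[sphere 0 1] ζ₀] fun ζ => ζ - ζ₀ := by
    refine .of_bound (Real.pi / 2) (eventually_mem_nhdsWithin.mono fun ζ hζ => ?_)
    have hζ1 := mem_sphere_zero_iff_norm.1 hζ
    rw [add_sub_cancel_left, Real.norm_eq_abs,
      ← angle_eq_abs_arg (ne_of_mem_sphere hζ one_ne_zero) hne]
    exact angle_le_mul_norm_sub hζ1 hn0
  have ht0 : Tendsto t (𝓝[sphere 0 1] ζ₀) (𝓝 θ) := by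
    rw [← tendsto_sub_nhds_zero_iff]
    exact hO.trans_tendsto (tendsto_sub_nhds_zero_iff.2 nhdsWithin_le_nhds)
  refine hasDerivWithinAt_iff_isLittleO.2 (.trans_isBigO ?_ hO)
  refine ((hasDerivAt_iff_isLittleO.1 hcircle).comp_tendsto ht0).congr' ?_ .rfl
  filter_upwards [self_mem_nhdsWithin] with ζ hζ
  simp [ht hζ, ← hζ₀]

theorem exists_lipschitzWith_primitive {f : ℂ → ℂ} (hf : DifferentiableOn ℂ f (ball 0 1))
    {C : ℝ} (hC : ∀ z ∈ ball (0 : ℂ) 1, ‖f z‖ ≤ C) :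
    ∃ K g, LipschitzWith K g ∧ ∀ z ∈ ball (0 : ℂ) 1, HasDerivAt g (f z) z := by
  obtain ⟨g₀, hg₀⟩ := hf.isExactOn_ball
  have hlip : LipschitzOnWith C.toNNReal g₀ (ball 0 1) := by
    refine (convex_ball (0 : ℂ) 1).lipschitzOnWith_of_nnnorm_deriv_le (𝕜 := ℂ)
      (fun z hz => (hg₀ z hz).differentiableAt) fun z hz => ?_
    rw [(hg₀ z hz).deriv, ← NNReal.coe_le_coe, coe_nnnorm]
    exact (hC z hz).trans (Real.le_coe_toNNReal C)
  obtain ⟨g, hg, hgg⟩ := hlip.extend_finite_dimension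
  exact ⟨_, g, hg, fun z hz => (hg₀ z hz).congr_of_eventuallyEq
    (eventuallyEq_of_mem (isOpen_ball.mem_nhds hz) hgg.symm)⟩

theorem ae_exists_radial_limit {f : ℂ → ℂ} (hf : DifferentiableOn ℂ f (ball 0 1)) {C : ℝ}
    (hC : ∀ z ∈ ball (0 : ℂ) 1, ‖f z‖ ≤ C) :
    ∀ᵐ θ : ℝ, ∃ c, Tendsto (fun r : ℝ => f (r * exp (θ * I))) (𝓝[<] 1) (𝓝 c) := by
  obtain ⟨K, g, hg, hgf⟩ := exists_lipschitzWith_primitive hf hC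
  have hdiff : DiffContOnCl ℂ g (ball 0 1) :=
    ⟨fun z hz => (hgf z hz).differentiableAt.differentiableWithinAt, hg.continuous.continuousOn⟩
  have hcircle : LipschitzWith (K * ‖(1 : ℝ)‖₊) fun θ : ℝ => g (circleMap 0 1 θ) :=
    hg.comp (lipschitzWith_circleMap 0 1)
  filter_upwards [hcircle.ae_differentiableAt] with θ hθ
  have hζ : circleMap 0 1 θ = exp (θ * I) := by simp [circleMap]
  have hlim := tendsto_deriv_of_hasDerivWithinAt_sphere hdiff (by simp)
    (hasDerivWithinAt_sphere_of_hasDerivAt_comp_circleMap hθ.hasDerivAt)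
  refine ⟨_, hlim.congr' ?_⟩
  filter_upwards [Ioo_mem_nhdsLT (zero_lt_one : (0 : ℝ) < 1)] with r hr
  rw [hζ, (hgf _ _).deriv]
  rw [mem_ball_zero_iff, norm_ofReal_mul_of_norm_eq_one (norm_exp_ofReal_mul_I θ) hr.1.le]
  exact hr.2

end Fatou

/-! ### Inner functions and isometric multiplication operators -/

theorem HardyTwo.tendsto_circleMean (f : HardyTwo) :
    Tendsto (circleMean f.toFun) (𝓝[<] 1) (𝓝 (‖f‖ ^ 2)) := by
  rw [norm_sq_eq_tsum]
  have hIoo : Set.Ioo (0 : ℝ) 1 ∈ 𝓝[<] 1 := Ioo_mem_nhdsLT zero_lt_one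
  have htsum : Tendsto (fun r : ℝ => ∑' n, ‖taylorCoeff f.toFun n‖ ^ 2 * r ^ (2 * n)) (𝓝[<] 1)
      (𝓝 (∑' n, ‖taylorCoeff f.toFun n‖ ^ 2)) := by
    refine tendsto_tsum_of_dominated_convergence f.summable (fun n => ?_) ?_
    · exact (Continuous.tendsto' (by fun_prop) _ _ (by simp)).mono_left nhdsWithin_le_nhds
    · filter_upwards [hIoo] with r hr n
      rw [Real.norm_of_nonneg (mul_nonneg (by positivity) (pow_nonneg hr.1.le _))]
      exact mul_le_of_le_one_right (by positivity) (pow_le_one₀ hr.1.le hr.2.le)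
  refine htsum.congr' ?_
  filter_upwards [hIoo] with r hr
  exact (f.analytic.hasSum_circleMean hr.1.le hr.2).tsum_eq

theorem continuous_discExt_circle {f : 𝔻 → ℂ} (hf : AnalyticOnDisc f) {r : ℝ}
    (hr : 0 ≤ r) (hr1 : r < 1) : Continuous fun θ : ℝ => discExt f (r * exp (θ * I)) :=
  (DifferentiableOn.continuousOn hf).comp_continuous (by fun_prop) fun θ => by
    rwa [mem_ball_zero_iff, norm_ofReal_mul_of_norm_eq_one (norm_exp_ofReal_mul_I θ) hr]

theorem norm_discExt_le {f : 𝔻 → ℂ} {C : ℝ} (hC : ∀ z, ‖f z‖ ≤ C) (z : ℂ) :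
    ‖discExt f z‖ ≤ C := by
  by_cases hz : ‖z‖ < 1
  · simpa [discExt, hz] using hC (UnitDisc.mk z hz)
  · simpa [discExt, hz] using (norm_nonneg _).trans (hC 0)

theorem norm_sq_eq_integral_of_tendsto_radial {f : HardyTwo} {C : ℝ}
    (hC : ∀ z, ‖f.toFun z‖ ≤ C) {c : ℝ → ℂ}
    (hc : ∀ᵐ θ : ℝ, Tendsto (fun r : ℝ => discExt f.toFun (r * exp (θ * I))) (𝓝[<] 1)
      (𝓝 (c θ))) :
    ‖f‖ ^ 2 = (2 * Real.pi)⁻¹ * ∫ θ in 0..2 * Real.pi, ‖c θ‖ ^ 2 := by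
  have hmean : circleMean f.toFun = fun r : ℝ => (2 * Real.pi)⁻¹ *
      ∫ θ in 0..2 * Real.pi, ‖discExt f.toFun (r * exp (θ * I))‖ ^ 2 := by
    ext r
    simp [circleMean, Real.circleAverage_def, circleMap]
  refine tendsto_nhds_unique f.tendsto_circleMean (hmean ▸ Tendsto.const_mul _ ?_)
  refine intervalIntegral.tendsto_integral_filter_of_dominated_convergence (fun _ => C ^ 2)
    ?_ (.of_forall fun r => .of_forall fun θ _ => ?_) intervalIntegrable_const
    (hc.mono fun θ h _ => h.norm.pow 2)
  · filter_upwards [Ioo_mem_nhdsLT (zero_lt_one : (0 : ℝ) < 1)] with r hr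
    exact ((continuous_discExt_circle f.analytic hr.1.le hr.2).norm.pow 2).aestronglyMeasurable
  · rw [Real.norm_of_nonneg (by positivity)]
    gcongr
    exact norm_discExt_le hC _

theorem aestronglyMeasurable_of_tendsto_radial {f : 𝔻 → ℂ} (hf : AnalyticOnDisc f) {c : ℝ → ℂ}
    (hc : ∀ᵐ θ : ℝ, Tendsto (fun r : ℝ => discExt f (r * exp (θ * I))) (𝓝[<] 1) (𝓝 (c θ))) :
    MeasureTheory.AEStronglyMeasurable c := by
  obtain ⟨s, -, hs, hs1⟩ := exists_seq_strictMono_tendsto' (zero_lt_one : (0 : ℝ) < 1)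
  have hs' : Tendsto s atTop (𝓝[<] 1) :=
    tendsto_nhdsWithin_iff.2 ⟨hs1, .of_forall fun n => (hs n).2⟩
  exact aestronglyMeasurable_of_tendsto_ae atTop
    (fun n => (continuous_discExt_circle hf (hs n).1.le (hs n).2).aestronglyMeasurable)
    (hc.mono fun θ h => h.comp hs')

theorem ae_of_periodic {P : ℝ → Prop} {T : ℝ} (hT : 0 < T) (hP : Function.Periodic P T)
    (h : ∀ᵐ θ ∂MeasureTheory.volume.restrict (Set.Ioc 0 T), P θ) : ∀ᵐ θ, P θ := by
  rw [MeasureTheory.ae_restrict_iff' measurableSet_Ioc] at h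
  have htranslate : ∀ᵐ θ : ℝ, ∀ k : ℤ, θ + k • T ∈ Set.Ioc 0 T → P (θ + k • T) :=
    MeasureTheory.ae_all_iff.2 fun k => (MeasureTheory.measurePreserving_add_right
      MeasureTheory.volume (k • T)).quasiMeasurePreserving.ae h
  filter_upwards [htranslate] with θ hθ
  obtain ⟨k, hk, -⟩ := existsUnique_add_zsmul_mem_Ioc hT θ 0
  rw [zero_add] at hk
  exact (hP.zsmul k θ).mp (hθ k hk)

theorem isInnerFunction_of_norm_smul_eq {J : HInfty} (hJ : ∀ f : HardyTwo, ‖J • f‖ = ‖f‖) :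
    IsInnerFunction J := by
  have hle (z : 𝔻) : ‖J.1 z‖ ≤ 1 :=
    (HardyTwo.norm_le_of_toFun_eq_mul (HardyTwo.mulCLM J) (HardyTwo.toFun_hsmul J) z).trans <|
      ContinuousLinearMap.opNorm_le_bound _ zero_le_one fun f => (hJ f).trans_le (one_mul _).ge
  have hone : (J • HardyTwo.monomialBasis 0).toFun = J.1 := by
    ext z
    rw [HardyTwo.toFun_hsmul, Pi.mul_apply, HardyTwo.monomialBasis_toFun, pow_zero, mul_one]
  obtain ⟨c, hc⟩ := (ae_exists_radial_limit J.2.1 fun z _ => norm_discExt_le hle z).choice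
  have hc1 : ∀ᵐ θ : ℝ, ‖c θ‖ ^ 2 ≤ 1 := hc.mono fun θ h => pow_le_one₀ (norm_nonneg _) <|
    le_of_tendsto h.norm (.of_forall fun r => norm_discExt_le hle _)
  have hmean := norm_sq_eq_integral_of_tendsto_radial (f := J • HardyTwo.monomialBasis 0)
    (by rwa [hone]) (by rwa [hone])
  rw [hJ, HardyTwo.monomialBasis.orthonormal.1 0, one_pow, eq_inv_mul_iff_mul_eq₀
    Real.two_pi_pos.ne', intervalIntegral.integral_of_le Real.two_pi_pos.le] at hmean
  have hint : MeasureTheory.IntegrableOn (fun θ => ‖c θ‖ ^ 2) (Set.Ioc 0 (2 * Real.pi)) :=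
    .of_bound measure_Ioc_lt_top
      ((aestronglyMeasurable_of_tendsto_radial J.2.1 hc).norm.pow 2).restrict 1
      (MeasureTheory.ae_restrict_of_ae (hc1.mono fun θ h => by simpa using h))
  have hae := (MeasureTheory.integral_eq_iff_of_ae_le hint (MeasureTheory.integrable_const 1)
    (MeasureTheory.ae_restrict_of_ae hc1)).1 (by rw [← hmean]; simp [Real.pi_nonneg])
  refine ae_of_periodic Real.two_pi_pos (fun θ => ?_) ?_
  · rw [ofReal_add, add_mul, exp_add]
    simp
  · filter_upwards [hae, MeasureTheory.ae_restrict_of_ae hc] with θ hθ hlim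
    exact ⟨c θ, (pow_eq_one_iff_of_nonneg (norm_nonneg _) two_ne_zero).1 hθ, hlim⟩

theorem tendsto_discExt_radial_of_continuous {F : ℂ → ℂ} (hF : Continuous F) (θ : ℝ) :
    Tendsto (fun r : ℝ => discExt (fun z : 𝔻 => F z) (r * exp (θ * I))) (𝓝[<] 1)
      (𝓝 (F (exp (θ * I)))) := by
  have hlim : Tendsto (fun r : ℝ => F (r * exp (θ * I))) (𝓝[<] 1) (𝓝 (F (exp (θ * I)))) :=
    (Continuous.tendsto' (by fun_prop) _ _ (by simp)).mono_left nhdsWithin_le_nhds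
  refine hlim.congr' ?_
  filter_upwards [Ioo_mem_nhdsLT (zero_lt_one : (0 : ℝ) < 1)] with r hr
  refine (discExt_of F ?_).symm
  rw [mem_ball_zero_iff, norm_ofReal_mul_of_norm_eq_one (norm_exp_ofReal_mul_I θ) hr.1.le]
  exact hr.2

theorem IsInnerFunction.norm_smul_eq_of_continuous {J : HInfty} (hJ : IsInnerFunction J)
    {f : HardyTwo} {F : ℂ → ℂ} (hF : Continuous F) (hf : f.toFun = fun z : 𝔻 => F z) :
    ‖J • f‖ = ‖f‖ := by
  obtain ⟨C, hC⟩ := J.2.2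
  obtain ⟨D, hD⟩ := (isCompact_closedBall (0 : ℂ) 1).exists_bound_of_continuousOn hF.continuousOn
  have hfD (z : 𝔻) : ‖f.toFun z‖ ≤ D := by
    rw [hf]
    exact hD _ (mem_closedBall_zero_iff.2 z.norm_lt_one.le)
  have hJfCD (z : 𝔻) : ‖(J • f).toFun z‖ ≤ C * D := by
    rw [HardyTwo.toFun_hsmul, Pi.mul_apply]
    exact norm_mul_le_of_le (hC z) (hfD z)
  have hflim (θ : ℝ) : Tendsto (fun r : ℝ => discExt f.toFun (r * exp (θ * I))) (𝓝[<] 1)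
      (𝓝 (F (exp (θ * I)))) := hf ▸ tendsto_discExt_radial_of_continuous hF θ
  obtain ⟨c, hc⟩ := hJ.choice
  have hJflim : ∀ᵐ θ : ℝ, Tendsto (fun r : ℝ => discExt (J • f).toFun (r * exp (θ * I)))
      (𝓝[<] 1) (𝓝 (c θ * F (exp (θ * I)))) := hc.mono fun θ h => by
    rw [HardyTwo.toFun_hsmul, discExt_mul]
    exact h.2.mul (hflim θ)
  rw [← sq_eq_sq₀ (norm_nonneg _) (norm_nonneg _),
    norm_sq_eq_integral_of_tendsto_radial hJfCD hJflim,
    norm_sq_eq_integral_of_tendsto_radial hfD (.of_forall hflim)]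
  congr 1
  refine intervalIntegral.integral_congr_ae (hc.mono fun θ h _ => ?_)
  rw [norm_mul, h.1, one_mul]

theorem IsInnerFunction.norm_smul_eq {J : HInfty} (hJ : IsInnerFunction J) (f : HardyTwo) :
    ‖J • f‖ = ‖f‖ := by
  have hpoly : ∀ f ∈ Submodule.span ℂ (Set.range HardyTwo.monomialBasis),
      ∃ F : ℂ → ℂ, Continuous F ∧ f.toFun = fun z : 𝔻 => F z := by
    intro f hf
    induction hf using Submodule.span_induction with
    | mem f hf =>
      obtain ⟨n, rfl⟩ := hf
      exact ⟨_, continuous_pow n, funext (HardyTwo.monomialBasis_toFun n)⟩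
    | zero => exact ⟨0, continuous_zero, rfl⟩
    | add f g _ _ hf hg =>
      obtain ⟨⟨F, hF, hf⟩, G, hG, hg⟩ := And.intro hf hg
      exact ⟨_, hF.add hG, by rw [HardyTwo.toFun_add, hf, hg]; rfl⟩
    | smul a f _ hf =>
      obtain ⟨F, hF, hf⟩ := hf
      exact ⟨_, hF.const_smul a, by rw [HardyTwo.toFun_smul, hf]; rfl⟩
  have hdense : Dense (Submodule.span ℂ (Set.range HardyTwo.monomialBasis) : Set HardyTwo) :=
    Submodule.dense_iff_topologicalClosure_eq_top.2 HardyTwo.monomialBasis.dense_span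
  refine congrFun (Continuous.ext_on hdense (HardyTwo.mulCLM J).continuous.norm continuous_norm
    fun f hf => ?_) f
  obtain ⟨F, hF, hfF⟩ := hpoly f hf
  exact hJ.norm_smul_eq_of_continuous hF hfF

/-! ### Beurling's theorem -/

theorem mulHardy_ne_bot {J : HInfty} (hJ : ∀ f : HardyTwo, ‖J • f‖ = ‖f‖) : mulHardy J ≠ ⊥ := by
  intro hbot
  have hzero := (Submodule.eq_bot_iff _).1 hbot _ ⟨HardyTwo.monomialBasis 0, rfl⟩
  have hnorm := hJ (HardyTwo.monomialBasis 0)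
  rw [hzero, norm_zero, HardyTwo.monomialBasis.orthonormal.1 0] at hnorm
  exact zero_ne_one hnorm

theorem isInvariantUnder_mulHardy (R : Subalgebra ℂ HInfty) (J : HInfty) :
    IsInvariantUnder R (mulHardy J) := by
  rintro r - _ ⟨f, rfl⟩
  exact ⟨r • f, smul_comm r J f⟩

theorem theorem8p1_general (R : Subalgebra ℂ HInfty) (hR : coordZ ∈ R) :
    (∀ V : Submodule ℂ HardyTwo, IsClosed (V : Set HardyTwo) → V ≠ ⊥ →
      IsNearInner R V → HasFullProjection R V →
        IsInvariantUnder R V ∧ ∃ I : HInfty, IsInnerFunction I ∧ V = mulHardy I) ∧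
    (∀ I : HInfty, IsInnerFunction I →
      IsClosed (mulHardy I : Set HardyTwo) ∧ mulHardy I ≠ ⊥ ∧
        IsInvariantUnder R (mulHardy I)) ∧
    (∀ V : Submodule ℂ HardyTwo, IsClosed (V : Set HardyTwo) → V ≠ ⊥ →
      (IsInvariantUnder R V ↔ ∃ I : HInfty, IsInnerFunction I ∧ V = mulHardy I)) := by
  have beurling (V : Submodule ℂ HardyTwo) (hV : IsClosed (V : Set HardyTwo)) (hne : V ≠ ⊥)
      (hinv : IsInvariantUnder R V) : ∃ I : HInfty, IsInnerFunction I ∧ V = mulHardy I := by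
    obtain ⟨J, hJ, hVJ⟩ := HardyTwo.exists_eq_mulHardy_of_mapsTo_shift hV hne fun f hf => by
      rw [HardyTwo.shift_apply]
      exact hinv coordZ hR f hf
    exact ⟨J, isInnerFunction_of_norm_smul_eq hJ, hVJ⟩
  refine ⟨fun V hV hne hN hF => ?_, fun J hJ => ?_, fun V hV hne => ⟨beurling V hV hne, ?_⟩⟩
  · have hinv := isInvariantUnder_of_isNearInner hV hN hF
    exact ⟨hinv, beurling V hV hne hinv⟩
  · exact ⟨HardyTwo.isClosed_mulHardy hJ.norm_smul_eq, mulHardy_ne_bot hJ.norm_smul_eq,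
      isInvariantUnder_mulHardy R J⟩
  · rintro ⟨J, -, rfl⟩
    exact isInvariantUnder_mulHardy R J

end

theorem theorem8p1 (R : Subalgebra ℂ HInfty) (hR : R = polyAlgebra ∨ R = ⊤) :
    (∀ V : Submodule ℂ HardyTwo, IsClosed (V : Set HardyTwo) → V ≠ ⊥ →
      IsNearInner R V → HasFullProjection R V →
        IsInvariantUnder R V ∧ ∃ I : HInfty, IsInnerFunction I ∧ V = mulHardy I) ∧
    (∀ I : HInfty, IsInnerFunction I →
      IsClosed (mulHardy I : Set HardyTwo) ∧ mulHardy I ≠ ⊥ ∧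
        IsInvariantUnder R (mulHardy I)) ∧
    (∀ V : Submodule ℂ HardyTwo, IsClosed (V : Set HardyTwo) → V ≠ ⊥ →
      (IsInvariantUnder R V ↔ ∃ I : HInfty, IsInnerFunction I ∧ V = mulHardy I)) := by
  refine theorem8p1_general R ?_
  rcases hR with rfl | rfl
  exacts [Algebra.self_mem_adjoin_singleton ℂ coordZ, Algebra.mem_top]
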